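/- For a finite set $X\subset\mathbb{R}^2$ (with the Euclidean metric) and a scale $r>0$, let $\mathcal{R}(X;r)$ be the planar-Rips complex, i.e. the abstract simplicial complex whose simplices are the nonempty subsets of $X$ of diameter at most $r$. Let $\mathcal{O}_2$ be the boundary complex of the octahedron: its vertices are the six points $\pm e_1,\pm e_2,\pm e_3$ and its simplices are the nonempty sets of vertices that contain no antipodal pair $\{e_i,-e_i\}$. Fix an integral domain $R$ of coefficients for homology (for instance $R=\mathbb{Z}$). A finite simplicial complex $K$ is a minimal $n$-cycle if it is $n$-dimensional and pure (every maximal simplex has dimension $n$), and $K$ itself is the only subcomplex $L\subseteq K$ whose $n$-th simplicial homology $H_n(L;R)$ has rank $1$. If $X\subset\mathbb{R}^2$ is finite, $r>0$, and $\mathcal{R}(X;r)$ is a minimal $2$-cycle, then $\mathcal{R}(X;r)$ is isomorphic, as a simplicial complex, to $\mathcal{O}_2$. -/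

import Mathlib

namespace PlanarRips

/-- The vertex set of an abstract simplicial complex. -/
def vertices {V : Type*} (K : PreAbstractSimplicialComplex V) : Set V :=
  {v | {v} ∈ K}

/-- Simplicial isomorphism: a bijection between the vertex sets under which faces correspond to
faces in both directions. -/
def Isomorphic {V W : Type*} (K : PreAbstractSimplicialComplex V)
    (L : PreAbstractSimplicialComplex W) : Prop :=
  ∃ e : vertices K ≃ vertices L, ∀ s : Finset (vertices K),
    s.map (Function.Embedding.subtype _) ∈ K ↔
      (s.map e.toEmbedding).map (Function.Embedding.subtype _) ∈ L

/-- The Vietoris–Rips complex of `X` at scale `r`: its simplices are the nonempty finite subsets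
of `X` of diameter at most `r`. -/
def ripsComplex {α : Type*} [PseudoMetricSpace α] (X : Set α) (r : ℝ) :
    PreAbstractSimplicialComplex α where
  faces := {s | s.Nonempty ∧ (s : Set α) ⊆ X ∧ Metric.diam (s : Set α) ≤ r}
  isRelLowerSet_faces := fun {s} hs =>
    ⟨hs.1, fun _ hts ht => ⟨ht, (Finset.coe_subset.2 hts).trans hs.2.1,
      (Metric.diam_mono (Finset.coe_subset.2 hts) s.finite_toSet.isBounded).trans hs.2.2⟩⟩

/-- The boundary complex `𝒪ₙ` of the `(n+1)`-dimensional cross-polytope. The vertices `(i, true)`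
and `(i, false)` stand for `e_i` and `-e_i`; the simplices are the nonempty sets of vertices that
contain no antipodal pair. `𝒪₂` is the boundary of the octahedron. -/
def crossPolytopeBoundary (n : ℕ) : PreAbstractSimplicialComplex (Fin (n + 1) × Bool) where
  faces := {s | s.Nonempty ∧ ∀ i, ¬ ((i, true) ∈ s ∧ (i, false) ∈ s)}
  isRelLowerSet_faces := fun {_} hs =>
    ⟨hs.1, fun _ hts ht => ⟨ht, fun i hi => hs.2 i ⟨hts hi.1, hts hi.2⟩⟩⟩

/-- `K` has dimension `n`: `n` is the largest dimension of a face, the dimension of a face being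
one less than its cardinality. -/
def HasDim {V : Type*} (K : PreAbstractSimplicialComplex V) (n : ℕ) : Prop :=
  (∃ s ∈ K, s.card = n + 1) ∧ ∀ s ∈ K, s.card ≤ n + 1

/-- An `n`-dimensional complex is pure if all its maximal simplices have dimension `n`. -/
def IsPureOfDim {V : Type*} (K : PreAbstractSimplicialComplex V) (n : ℕ) : Prop :=
  HasDim K n ∧ ∀ s, Maximal (· ∈ K) s → s.card = n + 1

section Homology

universe u v

variable (R : Type u) [CommRing R] {V : Type v}

/-- The module of oriented simplicial `n`-chains of `K` with coefficients in `R`, written as the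
alternating finitely supported functions on the vertex tuples `(v₀, …, vₙ)` of `n`-simplices. The
value at a tuple is the coefficient of the oriented simplex `[v₀, …, vₙ]`: the oriented simplex
itself corresponds to `∑ σ, sign σ • (v_{σ 0}, …, v_{σ n})`. -/
def chains (K : PreAbstractSimplicialComplex V) (n : ℕ) :
    Submodule R ((Fin (n + 1) → V) →₀ R) where
  carrier := {c |
    (∀ x, c x ≠ 0 → Function.Injective x ∧ ∃ s ∈ K, (s : Set V) = Set.range x) ∧
    ∀ (x : Fin (n + 1) → V) (σ : Equiv.Perm (Fin (n + 1))),
      c (x ∘ σ) = (Equiv.Perm.sign σ : ℤ) • c x}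
  zero_mem' := by simp
  add_mem' := by
    intro a b ha hb
    refine ⟨fun x hx => ?_, fun x σ => ?_⟩
    · by_cases h : a x = 0
      · exact hb.1 x (fun h' => hx (by simp [h, h']))
      · exact ha.1 x h
    · simp [ha.2 x σ, hb.2 x σ]
  smul_mem' := by
    intro r a ha
    refine ⟨fun x hx => ha.1 x (fun h => hx (by simp [h])), fun x σ => ?_⟩
    simp only [Finsupp.smul_apply, ha.2 x σ]
    exact smul_comm _ _ _

/-- The simplicial boundary operator: `(∂ c)(v₁, …, vₙ) = ∑ v, c (v, v₁, …, vₙ)`. On oriented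
simplices this is `∂ [v₀, …, vₙ] = ∑ i, (-1)ⁱ [v₀, …, v̂ᵢ, …, vₙ]`. -/
noncomputable def boundary (n : ℕ) :
    ((Fin (n + 1) → V) →₀ R) →ₗ[R] ((Fin n → V) →₀ R) :=
  Finsupp.lmapDomain R R Fin.tail

/-- The module of `n`-cycles; every `0`-chain is a cycle. -/
noncomputable def cycles (K : PreAbstractSimplicialComplex V) :
    (n : ℕ) → Submodule R ((Fin (n + 1) → V) →₀ R)
  | 0 => chains R K 0
  | n + 1 => chains R K (n + 1) ⊓ LinearMap.ker (boundary R (n + 1))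

/-- The module of `n`-boundaries. -/
noncomputable def boundaries (K : PreAbstractSimplicialComplex V) (n : ℕ) :
    Submodule R ((Fin (n + 1) → V) →₀ R) :=
  (chains R K (n + 1)).map (boundary R (n + 1))

open Classical in
theorem boundary_apply {n : ℕ} (c : (Fin (n + 1) → V) →₀ R) (y : Fin n → V) :
    boundary R n c y = ∑ x ∈ c.support with Fin.tail x = y, c x := by
  rw [boundary, Finsupp.lmapDomain_apply, Finsupp.mapDomain, Finsupp.sum, Finsupp.finsetSum_apply,
    Finset.sum_filter]
  simp [Finsupp.single_apply]

theorem boundary_mem_chains {K : PreAbstractSimplicialComplex V} {n : ℕ}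
    {c : (Fin (n + 2) → V) →₀ R} (hc : c ∈ chains R K (n + 1)) :
    boundary R (n + 1) c ∈ chains R K n := by
  classical
  refine ⟨fun y hy => ?_, fun y σ => ?_⟩
  · rw [boundary_apply] at hy
    obtain ⟨x, hx, hx0⟩ := Finset.exists_ne_zero_of_sum_ne_zero hy
    obtain ⟨-, rfl⟩ := Finset.mem_filter.1 hx
    obtain ⟨hinj, s, hs, hsx⟩ := hc.1 x hx0
    have himg : ((Finset.univ.image (Fin.tail x) : Finset V) : Set V) = Set.range (Fin.tail x) := by
      simp
    refine ⟨hinj.comp (Fin.succ_injective _), _, (K.isRelLowerSet_faces hs).2 ?_ ?_, himg⟩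
    · rw [← Finset.coe_subset, himg, hsx]
      rintro _ ⟨i, rfl⟩
      exact ⟨i.succ, rfl⟩
    · exact Finset.univ_nonempty.image _
  · set τ : Equiv.Perm (Fin (n + 2)) := Equiv.Perm.decomposeFin.symm (0, σ) with hτ
    have hsign : Equiv.Perm.sign τ = Equiv.Perm.sign σ := by
      simp [hτ]
    have htail : ∀ x : Fin (n + 2) → V, Fin.tail (x ∘ τ) = Fin.tail x ∘ σ := by
      intro x; funext i
      simp [Fin.tail, hτ]
    rw [boundary_apply, boundary_apply, Finset.smul_sum]
    symm
    refine Finset.sum_bij (fun x _ => x ∘ τ) ?_ ?_ ?_ ?_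
    · intro x hx
      obtain ⟨hs, rfl⟩ := Finset.mem_filter.1 hx
      refine Finset.mem_filter.2 ⟨?_, htail x⟩
      rw [Finsupp.mem_support_iff] at hs ⊢
      rw [hc.2 x τ]
      rcases Int.units_eq_one_or (Equiv.Perm.sign τ) with h | h <;> simp [h, hs]
    · intro x _ x' _ h
      exact (Equiv.surjective τ).injective_comp_right h
    · intro z hz
      obtain ⟨hs, hz⟩ := Finset.mem_filter.1 hz
      have hz' : (z ∘ τ.symm) ∘ τ = z := by funext i; simp
      refine ⟨z ∘ τ.symm, Finset.mem_filter.2 ⟨?_, ?_⟩, hz'⟩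
      · rw [Finsupp.mem_support_iff] at hs ⊢
        intro h0
        apply hs
        rw [← hz', hc.2, h0, smul_zero]
      · apply (Equiv.surjective σ).injective_comp_right
        show Fin.tail (z ∘ τ.symm) ∘ σ = y ∘ σ
        rw [← htail, hz', hz]
    · intro x _
      rw [hc.2 x τ, hsign]

theorem boundary_boundary {K : PreAbstractSimplicialComplex V} {n : ℕ}
    {c : (Fin (n + 2) → V) →₀ R} (hc : c ∈ chains R K (n + 1)) :
    boundary R n (boundary R (n + 1) c) = 0 := by
  classical
  ext y
  have key : boundary R n (boundary R (n + 1) c) y =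
      ∑ x ∈ c.support with Fin.tail (Fin.tail x) = y, c x := by
    rw [boundary, boundary, Finsupp.lmapDomain_apply, Finsupp.lmapDomain_apply,
      ← Finsupp.mapDomain_comp, Finsupp.mapDomain, Finsupp.sum, Finsupp.finsetSum_apply,
      Finset.sum_filter]
    simp [Finsupp.single_apply]
  rw [key]
  have h01 : (0 : Fin (n + 2)) ≠ 1 := by simp
  have hneg : ∀ x, c (x ∘ Equiv.swap 0 1) = - c x := by
    intro x
    rw [hc.2 x (Equiv.swap 0 1), Equiv.Perm.sign_swap h01]
    simp
  refine Finset.sum_involution (fun x _ => x ∘ Equiv.swap 0 1) ?_ ?_ ?_ ?_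
  · intro x _
    rw [hneg]; simp
  · intro x _ hx h
    have := congrFun h 0
    simp only [Function.comp_apply, Equiv.swap_apply_left] at this
    exact h01 ((hc.1 x hx).1 this).symm
  · intro x hx
    obtain ⟨hs, rfl⟩ := Finset.mem_filter.1 hx
    refine Finset.mem_filter.2 ⟨?_, ?_⟩
    · rw [Finsupp.mem_support_iff] at hs ⊢
      rw [hneg]; simpa using hs
    · funext i
      simp only [Fin.tail, Function.comp_apply]
      rw [Equiv.swap_apply_of_ne_of_ne]
      · exact Fin.succ_ne_zero _
      · intro h
        exact Fin.succ_ne_zero i (Fin.succ_injective _ (h.trans Fin.succ_zero_eq_one.symm))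
  · intro x _
    funext i
    simp

/-- Boundaries are cycles. -/
theorem boundaries_le_cycles (K : PreAbstractSimplicialComplex V) (n : ℕ) :
    boundaries R K n ≤ cycles R K n := by
  rintro _ ⟨c, hc, rfl⟩
  cases n with
  | zero => exact boundary_mem_chains R hc
  | succ n => exact ⟨boundary_mem_chains R hc, boundary_boundary R hc⟩

/-- The quotient `p / q` of submodules `q ≤ p` of an ambient module. -/
abbrev Subquotient {R : Type u} {M : Type v} [Ring R] [AddCommGroup M] [Module R M]
    (p q : Submodule R M) : Type v :=
  p ⧸ q.submoduleOf p

/-- The `n`-th simplicial homology module of `K` with coefficients in `R`: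
`n`-cycles modulo `n`-boundaries. -/
abbrev Homology (K : PreAbstractSimplicialComplex V) (n : ℕ) : Type (max u v) :=
  Subquotient (cycles R K n) (boundaries R K n)

/-- `K` is a minimal `n`-cycle: it is finite, `n`-dimensional and pure, and `K` itself is the only
subcomplex of `K` whose `n`-th homology has rank `1`. -/
def IsMinimalCycle (K : PreAbstractSimplicialComplex V) (n : ℕ) : Prop :=
  (K : Set (Finset V)).Finite ∧ IsPureOfDim K n ∧
    ∀ L : PreAbstractSimplicialComplex V, L ≤ K → (Module.rank R (Homology R L n) = 1 ↔ L = K)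

end Homology

end PlanarRips

/-!
Call two points of `X` adjacent if their distance is at most `r`. Since the complex has dimension
two, no four points of `X` are pairwise adjacent, so a triangle of the complex contains no point of
`X` besides its vertices. A nonzero cycle on a subcomplex forces that subcomplex to be everything
(`IsMinimalCycle.eq_of_cycle`), and an octahedron carries a nonzero cycle. So it is enough to find
six points of `X` that are pairwise adjacent except for three antipodal pairs (`exists_octahedron`).

Let `ab` be the longest edge. The complex is the support of a 2-cycle `z`, so `ab` lies in at least
two triangles of `z`. Two common neighbours of `a` and `b` on the same side of `ab` would be
adjacent, because `ab` is longest. Hence `a` and `b` have exactly two common neighbours, `c` and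
`d`, on opposite sides and not adjacent, and the segment `cd` meets the open segment `ab` in a
point `u` (`exists_diamond`). This configuration is called a diamond here.

The images in the plane of the triangles of `z` cover every generic point with total multiplicity
zero. The triangle `abc` covers the points next to `u` on the side of `c`, so some other triangle
`T` of `z` meets `ab` at `u`, and there are three possibilities.

* `T` has the vertex `a`, and its opposite edge crosses `ab`. Then this edge crosses `ab` strictly
  between `a` and `u`, so that `T` misses `u` (`Diamond.gap_pos_of_edge`).
* `T` has the vertex `b`. This is excluded by the mirror image of the same argument.
* Two edges `xy` and `xz` of `T` cross `ab`. Then `x` is `c` or `d`, and `a, b, c, d, y, z` are the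
  vertices of an octahedron (`Diamond.octahedron_of_cross`).

The metric input is only the inequality `xa + yb ≤ ab + xy` for crossing segments `ab` and `xy`
(`dist_add_dist_le_of_cross`) and the fact that a ball containing the vertices of a triangle
contains the triangle (`dist_le_of_area_nonneg`).

Instead of counting multiplicities at a point, `exists_unbalanced` uses that `∑ z(x) φ(x₁, x₂) = 0`
for every function `φ`, applied to the indicator function of the edges that descend across the line
`ab` beyond `u`. No general position of `X` is needed, and no division by `2`, so the argument works
over every domain.
-/

namespace PlanarRips

/-! ### Signed areas and crossing segments in the plane -/

/-- Twice the signed area of the triangle `pqs`, scaled by `e`. Statements are proved for all `e`,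
so that replacing `e` by `-e` exchanges the two sides of every line. -/
def area (e : ℝ) (p q s : EuclideanSpace ℝ (Fin 2)) : ℝ :=
  e * ((q 0 - p 0) * (s 1 - p 1) - (q 1 - p 1) * (s 0 - p 0))

theorem area_neg (e : ℝ) (p q s : EuclideanSpace ℝ (Fin 2)) : area (-e) p q s = -area e p q s := by
  simp only [area]; ring

theorem area_rotate (e : ℝ) (p q s : EuclideanSpace ℝ (Fin 2)) : area e q s p = area e p q s := by
  simp only [area]; ring

theorem area_swap (e : ℝ) (p q s : EuclideanSpace ℝ (Fin 2)) : area e q p s = -area e p q s := by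
  simp only [area]; ring

theorem area_swap_right (e : ℝ) (p q s : EuclideanSpace ℝ (Fin 2)) :
    area e p s q = -area e p q s := by
  simp only [area]; ring

@[simp] theorem area_self_left (e : ℝ) (p q : EuclideanSpace ℝ (Fin 2)) : area e p q p = 0 := by
  simp only [area]; ring

@[simp] theorem area_self_right (e : ℝ) (p q : EuclideanSpace ℝ (Fin 2)) : area e p q q = 0 := by
  simp only [area]; ring

/-- A convex combination of three points of a ball lies in the ball. The weights are not
normalised. -/
theorem dist_le_of_combo {w₁ w₂ w₃ : ℝ} {a b c p : EuclideanSpace ℝ (Fin 2)}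
    (h₁ : 0 ≤ w₁) (h₂ : 0 ≤ w₂) (h₃ : 0 ≤ w₃) (h : 0 < w₁ + w₂ + w₃)
    (hp : ∀ i, (w₁ + w₂ + w₃) * p i = w₁ * a i + w₂ * b i + w₃ * c i)
    {v : EuclideanSpace ℝ (Fin 2)} {ρ : ℝ} (ha : dist a v ≤ ρ) (hb : dist b v ≤ ρ)
    (hc : dist c v ≤ ρ) : dist p v ≤ ρ := by
  have key : (w₁ + w₂ + w₃) • (p - v) = w₁ • (a - v) + w₂ • (b - v) + w₃ • (c - v) := by
    ext i
    have := hp i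
    simp only [PiLp.smul_apply, PiLp.sub_apply, PiLp.add_apply, smul_eq_mul]
    linear_combination this
  rw [dist_eq_norm] at *
  have h2 : (w₁ + w₂ + w₃) * ‖p - v‖ ≤ (w₁ + w₂ + w₃) * ρ := by
    calc (w₁ + w₂ + w₃) * ‖p - v‖ = ‖(w₁ + w₂ + w₃) • (p - v)‖ := by
          rw [norm_smul, Real.norm_of_nonneg h.le]
      _ ≤ ‖w₁ • (a - v)‖ + ‖w₂ • (b - v)‖ + ‖w₃ • (c - v)‖ := by rw [key]; exact norm_add₃_le
      _ = w₁ * ‖a - v‖ + w₂ * ‖b - v‖ + w₃ * ‖c - v‖ := by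
          simp only [norm_smul, Real.norm_of_nonneg h₁, Real.norm_of_nonneg h₂,
            Real.norm_of_nonneg h₃]
      _ ≤ (w₁ + w₂ + w₃) * ρ := by
          rw [add_mul, add_mul]; gcongr
  exact le_of_mul_le_mul_left h2 h

/-- A ball around `v` that contains the vertices of a positively oriented triangle contains every
point `p` of the triangle; the areas in the hypotheses are the barycentric coordinates of `p`. -/
theorem dist_le_of_area_nonneg {e : ℝ} {a b c p : EuclideanSpace ℝ (Fin 2)}
    (h₁ : 0 ≤ area e b c p) (h₂ : 0 ≤ area e c a p) (h₃ : 0 ≤ area e a b p)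
    (h : 0 < area e a b c) {v : EuclideanSpace ℝ (Fin 2)} {ρ : ℝ} (ha : dist a v ≤ ρ)
    (hb : dist b v ≤ ρ) (hc : dist c v ≤ ρ) : dist p v ≤ ρ := by
  refine dist_le_of_combo h₁ h₂ h₃ ?_ ?_ ha hb hc
  · refine h.trans_eq ?_
    simp only [area]; ring
  · intro i
    fin_cases i <;> simp [area] <;> ring

/-- If the segments `ab` and `xy` meet, each pair of opposite sides of the quadrilateral with these
diagonals has total length at most `ab + xy`. -/
theorem dist_add_dist_le_of_cross {e : ℝ} {a b x y : EuclideanSpace ℝ (Fin 2)}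
    (hx : 0 ≤ area e a b x) (hy : area e a b y ≤ 0) (ha : area e x y a ≤ 0)
    (hb : 0 ≤ area e x y b) (h : 0 < area e a b x - area e a b y) :
    dist x a + dist y b ≤ dist a b + dist x y ∧ dist x b + dist y a ≤ dist a b + dist x y := by
  obtain ⟨p, hp, hp'⟩ : ∃ p, p ∈ segment ℝ a b ∧ p ∈ segment ℝ x y := by
    set Δ := area e a b x - area e a b y with hΔ
    have hΔ' : area e x y b - area e x y a = Δ := by simp only [hΔ, area]; ring
    refine ⟨(area e x y b / Δ) • a + (-area e x y a / Δ) • b,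
      ⟨_, _, div_nonneg hb h.le, div_nonneg (by linarith) h.le, ?_, rfl⟩,
      ⟨-area e a b y / Δ, area e a b x / Δ, div_nonneg (by linarith) h.le, div_nonneg hx h.le,
        ?_, ?_⟩⟩
    · rw [← add_div, div_eq_one_iff_eq h.ne']; linarith
    · rw [← add_div, div_eq_one_iff_eq h.ne']; linarith
    · ext i
      simp only [PiLp.smul_apply, PiLp.add_apply, smul_eq_mul]
      field_simp
      fin_cases i <;> simp [area] <;> ring
  have e₁ := dist_add_dist_of_mem_segment hp
  have e₂ := dist_add_dist_of_mem_segment hp'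
  rw [dist_comm p] at *
  have t₁ := dist_triangle x p a
  have t₂ := dist_triangle y p b
  have t₃ := dist_triangle x p b
  have t₄ := dist_triangle y p a
  simp only [dist_comm] at *
  constructor <;> linarith

/-- The segment from `y` to `x` enters the triangle `abc` through `ab`. If `c` is not on the same
side of the line `xy` as `b`, then the segment ends in the triangle or leaves it through `bc`; in
the latter case the inequalities for crossing segments hold. -/
theorem mem_triangle_or_dist_add_dist_le {e : ℝ} {a b c x y : EuclideanSpace ℝ (Fin 2)}
    (hc : 0 < area e a b c) (hx : 0 < area e a b x) (hy : area e a b y < 0)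
    (ha : area e x y a < 0) (hb : 0 < area e x y b) (hxyc : area e x y c ≤ 0) :
    (0 ≤ area e b c x ∧ 0 ≤ area e c a x) ∨
    (dist x b + dist y c ≤ dist b c + dist x y ∧ dist x c + dist y b ≤ dist b c + dist x y) := by
  rcases le_or_gt 0 (area e b c x) with h | h
  · left
    refine ⟨h, ?_⟩
    -- the affine function `area e x y` vanishes at `x`, here in barycentric coordinates of `x`
    have key : area e x y a * area e b c x + area e x y b * area e c a x
        + area e x y c * area e a b x = 0 := by simp only [area]; ring
    have h1 : 0 ≤ area e x y b * area e c a x := by nlinarith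
    exact nonneg_of_mul_nonneg_right h1 hb
  · right
    -- the affine function `area e b c` at the common point of `xy` and `ab`
    have key : area e a b x * area e b c y - area e a b y * area e b c x
        = area e x y b * area e a b c := by simp only [area]; ring
    have h1 : 0 < area e a b x * area e b c y := by nlinarith [mul_pos hb hc]
    have h2 : 0 < area e b c y := pos_of_mul_pos_right h1 hx.le
    have := dist_add_dist_le_of_cross (e := e) (a := c) (b := b) (x := x) (y := y)
      (by rw [area_swap]; linarith) (by rw [area_swap]; linarith) hxyc hb.le
      (by rw [area_swap e b c x, area_swap e b c y]; linarith)
    rw [dist_comm c b] at this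
    exact ⟨this.2, this.1⟩

/-! ### Diamonds: an edge with exactly two common neighbours -/

/-- No four points of `X` have pairwise distances at most `r`: a point `v` of `X` that is adjacent
to three distinct pairwise adjacent points of `X` is one of them. -/
def NoFourClique (X : Set (EuclideanSpace ℝ (Fin 2))) (r : ℝ) : Prop :=
  ∀ p ∈ X, ∀ q ∈ X, ∀ s ∈ X, ∀ v ∈ X, p ≠ q → q ≠ s → s ≠ p →
    dist p q ≤ r → dist q s ≤ r → dist s p ≤ r →
    dist p v ≤ r → dist q v ≤ r → dist s v ≤ r → v = p ∨ v = q ∨ v = s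

/-- An edge `ab` whose only common neighbours are `c` and `d`. These lie on opposite sides of `ab`,
are not adjacent, and the segment `cd` meets the open segment `ab`: in the affine relation
`E • c + C • d = A • a + B • b` with `C = area e a b c`, `E = -area e a b d`, the coefficients
`A = area e b c d` and `B = area e c a d` are positive. -/
structure Diamond (X : Set (EuclideanSpace ℝ (Fin 2))) (r e : ℝ)
    (a b c d : EuclideanSpace ℝ (Fin 2)) : Prop where
  noFour : NoFourClique X r
  memA : a ∈ X
  memB : b ∈ X
  memC : c ∈ X
  memD : d ∈ X
  distAB : dist a b ≤ r
  distAC : dist a c ≤ r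
  distBC : dist b c ≤ r
  distAD : dist a d ≤ r
  distBD : dist b d ≤ r
  distCD : r < dist c d
  posC : 0 < area e a b c
  negD : area e a b d < 0
  posA : 0 < area e b c d
  posB : 0 < area e c a d
  common : ∀ v ∈ X, dist a v ≤ r → dist b v ≤ r → v = a ∨ v = b ∨ v = c ∨ v = d

/-- The points `f i` of `X` are pairwise adjacent except for the antipodal pairs. -/
def IsOctahedron (X : Set (EuclideanSpace ℝ (Fin 2))) (r : ℝ)
    (f : Fin 3 × Bool → EuclideanSpace ℝ (Fin 2)) : Prop :=
  (∀ i, f i ∈ X) ∧ ∀ i j, dist (f i) (f j) ≤ r ↔ ¬ (i.1 = j.1 ∧ i.2 ≠ j.2)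

/-- An octahedron from its antipodal pairs `p₀q₀`, `p₁q₁` and `p₂q₂`. -/
theorem isOctahedron_of_dist {X : Set (EuclideanSpace ℝ (Fin 2))} {r : ℝ} (hr : 0 < r)
    {p₀ q₀ p₁ q₁ p₂ q₂ : EuclideanSpace ℝ (Fin 2)}
    (mp₀ : p₀ ∈ X) (mq₀ : q₀ ∈ X) (mp₁ : p₁ ∈ X) (mq₁ : q₁ ∈ X) (mp₂ : p₂ ∈ X) (mq₂ : q₂ ∈ X)
    (n₀ : r < dist p₀ q₀) (n₁ : r < dist p₁ q₁) (n₂ : r < dist p₂ q₂)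
    (h₁ : dist p₀ p₁ ≤ r) (h₂ : dist p₀ q₁ ≤ r) (h₃ : dist q₀ p₁ ≤ r) (h₄ : dist q₀ q₁ ≤ r)
    (h₅ : dist p₀ p₂ ≤ r) (h₆ : dist p₀ q₂ ≤ r) (h₇ : dist q₀ p₂ ≤ r) (h₈ : dist q₀ q₂ ≤ r)
    (h₉ : dist p₁ p₂ ≤ r) (h₁₀ : dist p₁ q₂ ≤ r) (h₁₁ : dist q₁ p₂ ≤ r) (h₁₂ : dist q₁ q₂ ≤ r) :
    ∃ f, IsOctahedron X r f := by
  refine ⟨fun i => if i.2 then ![p₀, p₁, p₂] i.1 else ![q₀, q₁, q₂] i.1, ?_, ?_⟩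
  · rintro ⟨i, s⟩
    fin_cases i <;> cases s <;> simp [*]
  · rintro ⟨i, s⟩ ⟨j, t⟩
    fin_cases i <;> fin_cases j <;> cases s <;> cases t <;>
      simp [*, hr.le] <;> rw [dist_comm] <;> assumption

namespace Diamond

variable {X : Set (EuclideanSpace ℝ (Fin 2))} {r e : ℝ}
  {a b c d x y z : EuclideanSpace ℝ (Fin 2)}

/-- The half-turn symmetry of a diamond. -/
theorem rotate (h : Diamond X r e a b c d) : Diamond X r e b a d c where
  noFour := h.noFour
  memA := h.memB
  memB := h.memA
  memC := h.memD
  memD := h.memC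
  distAB := by rw [dist_comm]; exact h.distAB
  distAC := h.distBD
  distBC := h.distAD
  distAD := h.distBC
  distBD := h.distAC
  distCD := by rw [dist_comm]; exact h.distCD
  posC := by have := h.negD; rw [area_swap]; linarith
  negD := by have := h.posC; rw [area_swap]; linarith
  posA := by rw [area_rotate]; exact h.posB
  posB := by rw [← area_rotate]; exact h.posA
  common v hv h1 h2 := by have := h.common v hv h2 h1; tauto

/-- The symmetry of a diamond that exchanges the two sides of `ab`. -/
theorem reflect (h : Diamond X r e a b c d) : Diamond X r (-e) a b d c where
  noFour := h.noFour
  memA := h.memA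
  memB := h.memB
  memC := h.memD
  memD := h.memC
  distAB := h.distAB
  distAC := h.distAD
  distBC := h.distBD
  distAD := h.distAC
  distBD := h.distBC
  distCD := by rw [dist_comm]; exact h.distCD
  posC := by have := h.negD; rw [area_neg]; linarith
  negD := by have := h.posC; rw [area_neg]; linarith
  posA := by have := h.posA; rwa [area_neg, area_swap_right, neg_neg]
  posB := by have := h.posB; rwa [area_neg, area_swap, neg_neg, area_rotate]
  common v hv h1 h2 := by have := h.common v hv h1 h2; tauto

theorem ne_AB (h : Diamond X r e a b c d) : a ≠ b := by
  rintro rfl; have := h.posC; simp [area] at this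

theorem ne_BC (h : Diamond X r e a b c d) : b ≠ c := by
  rintro rfl; have := h.posC; simp at this

theorem ne_CA (h : Diamond X r e a b c d) : c ≠ a := by
  rintro rfl; have := h.posC; simp at this

theorem eq_of_common_pos (h : Diamond X r e a b c d) (hx : x ∈ X) (h1 : dist a x ≤ r)
    (h2 : dist b x ≤ r) (hpos : 0 < area e a b x) : x = c := by
  rcases h.common x hx h1 h2 with rfl | rfl | rfl | rfl
  · simp at hpos
  · simp at hpos
  · rfl
  · exact absurd hpos h.negD.not_gt

theorem eq_of_common_neg (h : Diamond X r e a b c d) (hx : x ∈ X) (h1 : dist a x ≤ r)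
    (h2 : dist b x ≤ r) (hneg : area e a b x < 0) : x = d :=
  h.reflect.eq_of_common_pos hx h1 h2 (by rw [area_neg]; linarith)

/-- The triangle `abc` contains no point of `X` above `ab` other than `c`. -/
theorem not_mem_triangle (h : Diamond X r e a b c d) (hx : x ∈ X) (hpos : 0 < area e a b x)
    (hne : x ≠ c) : ¬ (0 ≤ area e b c x ∧ 0 ≤ area e c a x) := by
  rintro ⟨h1, h2⟩
  have hr : 0 ≤ r := dist_nonneg.trans h.distAB
  have key := fun v hav hbv hcv => dist_le_of_area_nonneg h1 h2 hpos.le h.posC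
    (v := v) (ρ := r) hav hbv hcv
  have ha := key a (by simpa using hr) (by rw [dist_comm]; exact h.distAB)
    (by rw [dist_comm]; exact h.distAC)
  have hb := key b h.distAB (by simpa using hr) (by rw [dist_comm]; exact h.distBC)
  rw [dist_comm] at ha hb
  exact hne (h.eq_of_common_pos hx ha hb hpos)

/-! ### Edges that cross a diamond inside a triangle at an end of its axis -/

/-- If an edge `xy` that spans a triangle with `a` crosses `ab`, then `c` is strictly on the side of
`b` unless `c = x`. Otherwise `xy` would cross `bc`, and `a, c, x, y` would be pairwise adjacent. -/
theorem edge_pos_C (h : Diamond X r e a b c d) (mx : x ∈ X) (my : y ∈ X) (hax : dist a x ≤ r)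
    (hay : dist a y ≤ r) (hxy : dist x y ≤ r) (hx : 0 < area e a b x) (hy : area e a b y < 0)
    (ha : area e x y a < 0) (hb : 0 < area e x y b) (hne : x ≠ c) : 0 < area e x y c := by
  by_contra! hcon
  rcases mem_triangle_or_dist_add_dist_le h.posC hx hy ha hb hcon with hh | ⟨h1, h2⟩
  · exact h.not_mem_triangle mx hx hne hh
  have hbx : r < dist x b := by
    by_contra! hh
    exact hne (h.eq_of_common_pos mx hax (by rwa [dist_comm]) hx)
  have hbc := h.distBC
  have hyc : dist y c ≤ r := by linarith
  have hby : r < dist y b := by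
    by_contra! hh
    rw [dist_comm] at hh
    have := h.eq_of_common_neg my hay hh hy
    subst this
    rw [dist_comm] at hyc
    exact h.distCD.not_ge hyc
  have hxc : dist x c ≤ r := by linarith
  have hxne : x ≠ y := by rintro rfl; linarith
  have hac : a ≠ x := by rintro rfl; simp at hx
  have hay' : y ≠ a := by rintro rfl; simp at hy
  rcases h.noFour a h.memA x mx y my c h.memC hac hxne hay' hax hxy (by rwa [dist_comm])
    h.distAC hxc hyc with rfl | rfl | rfl
  · exact h.ne_CA rfl
  · exact hne rfl
  · exact hy.not_gt h.posC

theorem edge_pos_D (h : Diamond X r e a b c d) (mx : x ∈ X) (my : y ∈ X) (hax : dist a x ≤ r)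
    (hay : dist a y ≤ r) (hxy : dist x y ≤ r) (hx : 0 < area e a b x) (hy : area e a b y < 0)
    (ha : area e x y a < 0) (hb : 0 < area e x y b) (hne : y ≠ d) : 0 < area e x y d := by
  have := h.reflect.edge_pos_C my mx hay hax (by rwa [dist_comm]) (by rw [area_neg]; linarith)
    (by rw [area_neg]; linarith) (by rw [area_neg, area_swap]; linarith)
    (by rw [area_neg, area_swap]; linarith) hne
  rwa [area_neg, area_swap, neg_neg] at this

/-- A positive multiple of `area e x y u`, where `u` is the point in which the segments `ab` and
`cd` of a diamond meet. For an edge that descends across `ab` from `x` to `y` it is negative if and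
only if the crossing lies beyond `u`, as seen from `a`. -/
def gap (e : ℝ) (a b c d x y : EuclideanSpace ℝ (Fin 2)) : ℝ :=
  -area e a b d * area e x y c + area e a b c * area e x y d

theorem gap_eq : gap e a b c d x y
    = area e b c d * area e x y a + area e c a d * area e x y b := by
  simp only [gap, area]; ring

/-- The edge opposite to `a` in a triangle at `a` crosses `ab` strictly before `u`. -/
theorem gap_pos_of_edge (h : Diamond X r e a b c d) (mx : x ∈ X) (my : y ∈ X) (hax : dist a x ≤ r)
    (hay : dist a y ≤ r) (hxy : dist x y ≤ r) (hx : 0 < area e a b x) (hy : area e a b y < 0)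
    (ha : area e x y a < 0) (hb : 0 < area e x y b) : 0 < gap e a b c d x y := by
  have hC := h.posC
  have hD := h.negD
  have h1 := h.edge_pos_C mx my hax hay hxy hx hy ha hb
  have h2 := h.edge_pos_D mx my hax hay hxy hx hy ha hb
  by_cases hxc : x = c
  · have hyd : y ≠ d := by
      rintro rfl; subst hxc; exact h.distCD.not_ge hxy
    subst hxc
    have := mul_pos hC (h2 hyd)
    simpa [gap] using this
  · have := mul_pos (neg_pos.2 hD) (h1 hxc)
    by_cases hyd : y = d
    · subst hyd
      simpa [gap] using this
    · have := mul_pos hC (h2 hyd)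
      unfold gap; linarith

/-- The edge opposite to `b` in a triangle at `b` crosses `ab` strictly beyond `u`. -/
theorem gap_neg_of_edge (h : Diamond X r e a b c d) (mx : x ∈ X) (my : y ∈ X) (hbx : dist b x ≤ r)
    (hby : dist b y ≤ r) (hxy : dist x y ≤ r) (hx : 0 < area e a b x) (hy : area e a b y < 0)
    (ha : area e x y a < 0) (hb : 0 < area e x y b) : gap e a b c d x y < 0 := by
  have := h.rotate.reflect.gap_pos_of_edge mx my hbx hby hxy (by rw [area_neg, area_swap]; linarith)
    (by rw [area_neg, area_swap]; linarith) (by rw [area_neg]; linarith)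
    (by rw [area_neg]; linarith)
  have e1 : gap (-e) b a c d x y = - gap e a b c d x y := by
    simp only [gap, area]; ring
  rw [e1] at this; linarith

/-! ### Triangles with two edges across the axis of a diamond -/

/-- The symmetry of a diamond that exchanges `a` and `b` and keeps `c` and `d`. -/
theorem mirror (h : Diamond X r e a b c d) : Diamond X r (-e) b a c d := h.rotate.reflect

theorem not_mem_triangle_D (h : Diamond X r e a b c d) (hy : y ∈ X) (hneg : area e a b y < 0)
    (hne : y ≠ d) : ¬ (0 ≤ area e a d y ∧ 0 ≤ area e d b y) :=
  h.rotate.not_mem_triangle hy (by rw [area_swap]; linarith) hne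

/-- An edge from `c` across `ab` that passes `d` on the side of `a` crosses `ad`; since `c` and `d`
are not adjacent, its endpoint is adjacent to `a`. -/
theorem dist_A_le (h : Diamond X r e a b c d) (my : y ∈ X) (hcy : dist c y ≤ r)
    (hy : area e a b y < 0) (ha : area e c y a < 0) (hb : 0 < area e c y b)
    (hd : 0 ≤ area e c y d) : dist a y ≤ r := by
  have hyd : y ≠ d := by rintro rfl; exact h.distCD.not_ge hcy
  rcases mem_triangle_or_dist_add_dist_le (e := e) (a := b) (b := a) (c := d) (x := y) (y := c)
    h.rotate.posC
    (by rw [area_swap]; linarith) h.rotate.negD (by rw [area_swap]; linarith)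
    (by rw [area_swap]; linarith) (by rw [area_swap]; linarith) with hh | ⟨h1, -⟩
  · exact absurd hh (h.not_mem_triangle_D my hy hyd)
  · have := h.distAD
    have := h.distCD
    rw [dist_comm y c] at h1
    rw [dist_comm a y]
    linarith

theorem dist_B_le (h : Diamond X r e a b c d) (my : y ∈ X) (hcy : dist c y ≤ r)
    (hy : area e a b y < 0) (ha : area e c y a < 0) (hb : 0 < area e c y b)
    (hd : area e c y d ≤ 0) : dist b y ≤ r :=
  h.mirror.dist_A_le my hcy (by rw [area_neg, area_swap]; linarith) (by rw [area_neg]; linarith)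
    (by rw [area_neg]; linarith) (by rw [area_neg]; linarith)

/-- An edge from `c` across `ab` that passes `d` on the side of `a` ends beyond `ad`. -/
theorem area_AD_neg (h : Diamond X r e a b c d) (my : y ∈ X) (hcy : dist c y ≤ r)
    (hy : area e a b y < 0) (ha : area e c y a < 0) (hb : 0 < area e c y b)
    (hd : 0 < area e c y d) : area e a d y < 0 := by
  have hyd : y ≠ d := by rintro rfl; exact h.distCD.not_ge hcy
  by_contra! hcon
  refine h.not_mem_triangle_D my hy hyd ⟨hcon, ?_⟩
  -- the affine function `area e c y` vanishes at `y`, here in barycentric coordinates of `y`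
  have key : area e c y a * area e d b y - area e c y d * area e a b y
      + area e c y b * area e a d y = 0 := by simp only [area]; ring
  by_contra! h1
  nlinarith [mul_pos_of_neg_of_neg ha h1, mul_neg_of_pos_of_neg hd hy, mul_nonneg hb.le hcon]

/-- If the edges of a triangle `cyz` leave the diamond through `ad` and `bd`, then `yz` crosses
`ad`, and `y` is adjacent to `d` because `z` is not adjacent to `a`. -/
theorem dist_D_le (h : Diamond X r e a b c d) (my : y ∈ X) (mz : z ∈ X) (hcy : dist c y ≤ r)
    (hcz : dist c z ≤ r) (hyz : dist y z ≤ r) (hy : area e a b y < 0) (hz : area e a b z < 0)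
    (hya : area e c y a < 0) (hyb : 0 < area e c y b)
    (hza : area e c z a < 0) (hzb : 0 < area e c z b)
    (hyd : 0 < area e c y d) (hzd : area e c z d < 0) (haz : r < dist a z) : dist y d ≤ r := by
  have hr : 0 ≤ r := dist_nonneg.trans h.distAB
  have hC := h.posC
  have hD := h.negD
  have hcd := h.distCD
  -- seen from `c`, the vertex `y` is on the side of `a` and `z` on the side of `b`
  have h₁ : 0 < area e c y z := by
    have key : (area e a b d - area e a b c) * area e c y z
      = (area e a b y - area e a b c) * -area e c z d
        + (area e a b z - area e a b c) * area e c y d := by simp only [area]; ring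
    by_contra! hcon
    nlinarith [mul_nonneg (show 0 ≤ area e a b c - area e a b d by linarith) (neg_nonneg.2 hcon),
      mul_pos (show 0 < area e a b c - area e a b y by linarith) (neg_pos.2 hzd),
      mul_pos (show 0 < area e a b c - area e a b z by linarith) hyd]
  -- `d` lies beyond `yz`, since otherwise it would lie in the triangle `cyz`
  have h₂ : area e y z d < 0 := by
    by_contra! hcon
    have := dist_le_of_area_nonneg (p := d) hcon (by rw [area_swap]; linarith) hyd.le h₁
      (v := c) (ρ := r) (by simpa using hr) (by rwa [dist_comm]) (by rwa [dist_comm])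
    rw [dist_comm] at this
    linarith
  have h₃ := h.area_AD_neg my hcy hy hya hyb hyd
  have h₄ : area e d b z < 0 := by
    have := h.mirror.area_AD_neg mz hcz (by rw [area_neg, area_swap]; linarith)
      (by rw [area_neg]; linarith) (by rw [area_neg]; linarith) (by rw [area_neg]; linarith)
    rwa [area_neg, ← area_swap] at this
  -- otherwise `d` would lie in the triangle `azb`, whose vertices are adjacent to `c`
  have h₅ : 0 < area e a d z := by
    by_contra! hcon
    have := dist_le_of_area_nonneg (e := e) (a := a) (b := z) (c := b) (p := d)
      (by rw [area_rotate, area_swap_right]; linarith)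
      (by rw [area_swap]; linarith)
      (by rw [area_swap_right]; linarith) (by rw [area_swap_right]; linarith)
      (v := c) (ρ := r) h.distAC (by rwa [dist_comm]) h.distBC
    rw [dist_comm] at this
    linarith
  -- `a` lies before `yz`: evaluate `area e y z` at the point where `cy` meets `ad`
  have h₆ : 0 < area e y z a := by
    have key : area e y z a * area e c y d - area e y z d * area e c y a
        = - area e a d y * area e c y z := by simp only [area]; ring
    have p1 := mul_pos_of_neg_of_neg h₂ hya
    have p2 := mul_pos (neg_pos.2 h₃) h₁
    exact pos_of_mul_pos_left (by linarith : 0 < area e y z a * area e c y d) hyd.le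
  have := (dist_add_dist_le_of_cross (e := e) (a := d) (b := a) (x := y) (y := z)
    (by rw [area_swap]; linarith) (by rw [area_swap]; linarith) h₂.le h₆.le
    (by rw [area_swap e a d y, area_swap e a d z]; linarith)).1
  have := h.distAD
  rw [dist_comm d a, dist_comm z a] at *
  linarith

theorem octahedron_of_apex_C_of_sides (h : Diamond X r e a b c d) (my : y ∈ X) (mz : z ∈ X)
    (hcy : dist c y ≤ r) (hcz : dist c z ≤ r) (hyz : dist y z ≤ r)
    (hy : area e a b y < 0) (hz : area e a b z < 0)
    (hya : area e c y a < 0) (hyb : 0 < area e c y b)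
    (hza : area e c z a < 0) (hzb : 0 < area e c z b)
    (hyd : 0 ≤ area e c y d) (hzd : area e c z d ≤ 0) : ∃ f, IsOctahedron X r f := by
  have hay := h.dist_A_le my hcy hy hya hyb hyd
  have hbz := h.dist_B_le mz hcz hz hza hzb hzd
  have hby : r < dist b y := by
    by_contra! hh
    have := h.eq_of_common_neg my hay hh hy
    subst this
    exact h.distCD.not_ge hcy
  have haz : r < dist a z := by
    by_contra! hh
    have := h.eq_of_common_neg mz hh hbz hz
    subst this
    exact h.distCD.not_ge hcz
  have hyd' : 0 < area e c y d := by
    by_contra! hh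
    exact hby.not_ge (h.dist_B_le my hcy hy hya hyb hh)
  have hzd' : area e c z d < 0 := by
    by_contra! hh
    exact haz.not_ge (h.dist_A_le mz hcz hz hza hzb hh)
  have h1 := h.dist_D_le my mz hcy hcz hyz hy hz hya hyb hza hzb hyd' hzd' haz
  have h2 := h.mirror.dist_D_le mz my hcz hcy (by rwa [dist_comm])
    (by rw [area_neg, area_swap]; linarith) (by rw [area_neg, area_swap]; linarith)
    (by rw [area_neg]; linarith) (by rw [area_neg]; linarith)
    (by rw [area_neg]; linarith) (by rw [area_neg]; linarith)
    (by rw [area_neg]; linarith) (by rw [area_neg]; linarith) hby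
  have hr : 0 < r := by
    refine lt_of_lt_of_le (dist_pos.2 h.ne_AB) h.distAB
  refine isOctahedron_of_dist hr h.memA mz h.memB my h.memC h.memD haz hby h.distCD
    h.distAB hay (by rw [dist_comm]; exact hbz) (by rwa [dist_comm])
    h.distAC h.distAD (by rwa [dist_comm]) h2 h.distBC h.distBD (by rwa [dist_comm]) h1

/-- A triangle `cyz` whose edges `cy` and `cz` cross `ab` completes the diamond to an octahedron
with antipodal pairs `cd`, `az` and `by`, or `cd`, `ay` and `bz`. -/
theorem octahedron_of_apex_C (h : Diamond X r e a b c d) (my : y ∈ X) (mz : z ∈ X) (hne : y ≠ z)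
    (hcy : dist c y ≤ r) (hcz : dist c z ≤ r) (hyz : dist y z ≤ r)
    (hy : area e a b y < 0) (hz : area e a b z < 0)
    (hya : area e c y a < 0) (hyb : 0 < area e c y b)
    (hza : area e c z a < 0) (hzb : 0 < area e c z b) : ∃ f, IsOctahedron X r f := by
  have hC := h.posC
  have hcy' : c ≠ y := by rintro rfl; linarith
  have hcz' : c ≠ z := by rintro rfl; linarith
  have hay' : a ≠ y := by rintro rfl; simp at hy
  have hby' : b ≠ y := by rintro rfl; simp at hy
  have haz' : a ≠ z := by rintro rfl; simp at hz
  have hbz' : b ≠ z := by rintro rfl; simp at hz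
  rcases le_total 0 (area e c y d) with h1 | h1 <;> rcases le_total 0 (area e c z d) with h2 | h2
  · have hay := h.dist_A_le my hcy hy hya hyb h1
    have haz := h.dist_A_le mz hcz hz hza hzb h2
    have := h.noFour c h.memC y my z mz a h.memA hcy' hne hcz'.symm hcy hyz
      (by rwa [dist_comm]) (by rw [dist_comm]; exact h.distAC) (by rwa [dist_comm])
      (by rwa [dist_comm])
    have := h.ne_CA
    tauto
  · exact h.octahedron_of_apex_C_of_sides my mz hcy hcz hyz hy hz hya hyb hza hzb h1 h2
  · exact h.octahedron_of_apex_C_of_sides mz my hcz hcy (by rwa [dist_comm]) hz hy hza hzb hya hyb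
      h2 h1
  · have hby := h.dist_B_le my hcy hy hya hyb h1
    have hbz := h.dist_B_le mz hcz hz hza hzb h2
    have := h.noFour c h.memC y my z mz b h.memB hcy' hne hcz'.symm hcy hyz
      (by rwa [dist_comm]) (by rw [dist_comm]; exact h.distBC) (by rwa [dist_comm])
      (by rwa [dist_comm])
    have := h.ne_BC
    tauto

/-- For an edge `xy` across `ab`, the four-point inequality makes `a` or `b` adjacent to both `x`
and `y`, unless one of `x`, `y` is a common neighbour of `a` and `b`. -/
theorem adjacent_of_cross (h : Diamond X r e a b c d) (my : y ∈ X)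
    (hxy : dist x y ≤ r) (hx : 0 < area e a b x) (hy : area e a b y < 0)
    (hya : area e x y a < 0) (hyb : 0 < area e x y b) (hxab : ¬ (dist a x ≤ r ∧ dist b x ≤ r)) :
    y = d ∨ (dist a x ≤ r ∧ dist a y ≤ r) ∨ (dist b x ≤ r ∧ dist b y ≤ r) := by
  have hcr := dist_add_dist_le_of_cross hx.le hy.le hya.le hyb.le (by linarith)
  have := h.distAB
  rw [dist_comm x a, dist_comm x b, dist_comm y a, dist_comm y b] at hcr
  have := h.eq_of_common_neg my (e := e)
  rcases le_or_gt (dist a x) r with h1 | h1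
  · have h2 : r < dist b x := by by_contra! hh; exact hxab ⟨h1, hh⟩
    exact Or.inr (Or.inl ⟨h1, by linarith⟩)
  · have h3 : dist b y ≤ r := by linarith
    rcases le_or_gt (dist b x) r with h2 | h2
    · exact Or.inr (Or.inr ⟨h2, h3⟩)
    · exact Or.inl (this (by linarith) h3 hy)

/-- If two edges `xy` and `xz` of a triangle cross `ab`, then `x = c` when `x` is on the side of
`c`, and there is an octahedron. -/
theorem octahedron_of_cross (h : Diamond X r e a b c d) (mx : x ∈ X) (my : y ∈ X) (mz : z ∈ X)
    (hne : y ≠ z) (hxy : dist x y ≤ r) (hxz : dist x z ≤ r) (hyz : dist y z ≤ r)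
    (hx : 0 < area e a b x) (hy : area e a b y < 0) (hz : area e a b z < 0)
    (hya : area e x y a < 0) (hyb : 0 < area e x y b)
    (hza : area e x z a < 0) (hzb : 0 < area e x z b) : ∃ f, IsOctahedron X r f := by
  by_cases hxab : dist a x ≤ r ∧ dist b x ≤ r
  · obtain rfl := h.eq_of_common_pos mx hxab.1 hxab.2 hx
    exact h.octahedron_of_apex_C my mz hne hxy hxz hyz hy hz hya hyb hza hzb
  exfalso
  have hxy' : x ≠ y := by rintro rfl; linarith
  have hxz' : z ≠ x := by rintro rfl; linarith
  have hA : ¬ (dist a x ≤ r ∧ dist a y ≤ r ∧ dist a z ≤ r) := by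
    rintro ⟨h1, h2, h3⟩
    rcases h.noFour x mx y my z mz a h.memA hxy' hne hxz' hxy hyz (by rwa [dist_comm])
      (by rwa [dist_comm]) (by rwa [dist_comm]) (by rwa [dist_comm]) with rfl | rfl | rfl
    · simp at hx
    · simp at hy
    · simp at hz
  have hB : ¬ (dist b x ≤ r ∧ dist b y ≤ r ∧ dist b z ≤ r) := by
    rintro ⟨h1, h2, h3⟩
    rcases h.noFour x mx y my z mz b h.memB hxy' hne hxz' hxy hyz (by rwa [dist_comm])
      (by rwa [dist_comm]) (by rwa [dist_comm]) (by rwa [dist_comm]) with rfl | rfl | rfl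
    · simp at hx
    · simp at hy
    · simp at hz
  have had := h.distAD
  have hbd := h.distBD
  rcases h.adjacent_of_cross my hxy hx hy hya hyb hxab with rfl | h1 | h1 <;>
    rcases h.adjacent_of_cross mz hxz hx hz hza hzb hxab with rfl | h2 | h2 <;> tauto

/-! ### Triangles that cover the centre of a diamond -/

/-- The open segment `ab` contains no point of `X`. -/
theorem area_ne_zero_of_cross (h : Diamond X r e a b c d) (my : y ∈ X)
    (ha : area e x y a < 0) (hb : 0 < area e x y b) : area e a b y ≠ 0 := by
  intro h0
  -- otherwise `y` is a convex combination of `a` and `b`, hence adjacent to both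
  have key := fun v => dist_le_of_combo (w₁ := area e x y b) (w₂ := -area e x y a) (w₃ := 0)
    (a := a) (b := b) (c := b) (p := y) hb.le (by linarith) le_rfl (by linarith) (by
      intro i
      have : (area e x y b - area e x y a) * y i
          = area e x y b * a i - area e x y a * b i - area e a b y * (y i - x i) := by
        fin_cases i <;> simp [area] <;> ring
      rw [h0] at this
      linear_combination this) (v := v) (ρ := r)
  have hr : 0 ≤ r := dist_nonneg.trans h.distAB
  have hab := h.distAB
  have hab' := h.distAB
  rw [dist_comm] at hab'
  rcases h.common y my (by rw [dist_comm]; exact key a (by simpa using hr) hab' hab')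
    (by rw [dist_comm]; exact key b hab (by simpa using hr) (by simpa using hr))
    with rfl | rfl | rfl | rfl
  · simp at ha
  · simp at hb
  · exact h.posC.ne' h0
  · exact h.negD.ne h0

/-- A triangle with apex `x` above the line `ab` and no other vertex above it meets this line in the
segment between the crossings of `xy` and `xz`. A point `p` of `X` in this segment is a vertex. -/
theorem eq_vertex_of_below (hX : NoFourClique X r) (mx : x ∈ X) (my : y ∈ X) (mz : z ∈ X)
    (hxy' : x ≠ y) (hyz' : y ≠ z) (hzx' : z ≠ x)
    (hxy : dist x y ≤ r) (hxz : dist x z ≤ r) (hyz : dist y z ≤ r)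
    {p : EuclideanSpace ℝ (Fin 2)} (mp : p ∈ X) (hp : area e a b p = 0)
    (hx : 0 < area e a b x) (hy : area e a b y ≤ 0) (hz : area e a b z ≤ 0)
    (h1 : area e x y p ≤ 0) (h2 : 0 ≤ area e x z p) (h3 : 0 < area e x z p - area e x y p) :
    p = x ∨ p = y ∨ p = z := by
  have hr : 0 ≤ r := dist_nonneg.trans hxy
  have key : area e z y p * area e a b x + area e y x p * area e a b z
      + area e x z p * area e a b y = area e x z y * area e a b p := by simp only [area]; ring
  rw [hp, mul_zero, area_swap e x y] at key
  have h4 : 0 ≤ area e z y p := by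
    by_contra! hh
    nlinarith [mul_neg_of_neg_of_pos hh hx, mul_nonneg (neg_nonneg.2 h1) (neg_nonneg.2 hz),
      mul_nonneg h2 (neg_nonneg.2 hy)]
  have tri := fun v => dist_le_of_area_nonneg (e := e) (a := x) (b := z) (c := y) (p := p) h4
    (by rw [area_swap]; linarith) h2 (by
      have : area e x z y = area e z y p + area e y x p + area e x z p := by
        simp only [area]; ring
      rw [this, area_swap e x y]; linarith) (v := v) (ρ := r)
  refine hX x mx y my z mz p mp hxy' hyz' hzx' hxy hyz (by rwa [dist_comm]) ?_ ?_ ?_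
  · rw [dist_comm]; exact tri x (by simpa using hr) (by rwa [dist_comm]) (by rwa [dist_comm])
  · rw [dist_comm]; exact tri y hxy (by rwa [dist_comm]) (by simpa using hr)
  · rw [dist_comm]; exact tri z hxz (by simpa using hr) hyz

/-- The same as `eq_vertex_of_below` for a triangle with only `x` on or below the line `ab`. -/
theorem eq_vertex_of_above (hX : NoFourClique X r) (mx : x ∈ X) (my : y ∈ X) (mz : z ∈ X)
    (hxy' : x ≠ y) (hyz' : y ≠ z) (hzx' : z ≠ x)
    (hxy : dist x y ≤ r) (hxz : dist x z ≤ r) (hyz : dist y z ≤ r)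
    {p : EuclideanSpace ℝ (Fin 2)} (mp : p ∈ X) (hp : area e a b p = 0)
    (hx : area e a b x ≤ 0) (hy : 0 < area e a b y) (hz : 0 < area e a b z)
    (h1 : area e y x p ≤ 0) (h2 : 0 ≤ area e z x p) (h3 : 0 < area e z x p - area e y x p) :
    p = x ∨ p = y ∨ p = z := by
  have hr : 0 ≤ r := dist_nonneg.trans hxy
  have key : area e y z p * area e a b x + area e z x p * area e a b y
      + area e x y p * area e a b z = area e x y z * area e a b p := by simp only [area]; ring
  rw [hp, mul_zero, area_swap e y x] at key
  have h4 : 0 ≤ area e y z p := by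
    by_contra! hh
    have := mul_nonneg h2 hy.le
    have := mul_nonneg (neg_nonneg.2 h1) hz.le
    have := mul_nonneg (neg_nonneg.2 hh.le) (neg_nonneg.2 hx)
    have h5 : area e z x p * area e a b y = 0 := by nlinarith
    have h6 : -area e y x p * area e a b z = 0 := by nlinarith
    rcases mul_eq_zero.1 h5 with h5 | h5 <;> rcases mul_eq_zero.1 h6 with h6 | h6 <;> linarith
  have tri := fun v => dist_le_of_area_nonneg (e := e) (a := x) (b := y) (c := z) (p := p) h4
    h2 (by rw [area_swap]; linarith) (by
      have : area e x y z = area e y z p + area e z x p + area e x y p := by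
        simp only [area]; ring
      rw [this, area_swap e y x]; linarith) (v := v) (ρ := r)
  refine hX x mx y my z mz p mp hxy' hyz' hzx' hxy hyz (by rwa [dist_comm]) ?_ ?_ ?_
  · rw [dist_comm]; exact tri x (by simpa using hr) (by rwa [dist_comm]) (by rwa [dist_comm])
  · rw [dist_comm]; exact tri y hxy (by simpa using hr) (by rwa [dist_comm])
  · rw [dist_comm]; exact tri z hxz hyz (by simpa using hr)

theorem area_sub_area : area e x y b - area e x y a = area e a b x - area e a b y := by
  simp only [area]; ring

theorem area_A_neg_of_gap (h : Diamond X r e a b c d) (hx : 0 < area e a b x)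
    (hy : area e a b y ≤ 0) (hg : gap e a b c d x y < 0) : area e x y a < 0 := by
  have := area_sub_area (e := e) (x := x) (y := y) (a := a) (b := b)
  by_contra! hh
  rw [gap_eq] at hg
  have := mul_nonneg h.posA.le hh
  have := mul_nonneg h.posB.le (show 0 ≤ area e x y b by linarith)
  linarith

theorem area_B_pos_of_gap (h : Diamond X r e a b c d) (hx : 0 < area e a b x)
    (hy : area e a b y ≤ 0) (hg : 0 ≤ gap e a b c d x y) : 0 < area e x y b := by
  have := area_sub_area (e := e) (x := x) (y := y) (a := a) (b := b)
  by_contra! hh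
  rw [gap_eq] at hg
  have := mul_nonneg h.posB.le (neg_nonneg.2 hh)
  have := mul_pos h.posA (show 0 < -area e x y a by linarith)
  linarith

theorem gap_A_pos (h : Diamond X r e a b c d) (hx : 0 < area e a b x) :
    0 < gap e a b c d x a := by
  rw [gap_eq, area_self_right, mul_zero, zero_add, ← area_rotate e x a b]
  exact mul_pos h.posB hx

theorem gap_B_neg (h : Diamond X r e a b c d) (hx : 0 < area e a b x) :
    gap e a b c d x b < 0 := by
  rw [gap_eq, area_self_right, area_swap_right e x a b,
    ← area_rotate e x a b]
  have := mul_pos h.posA hx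
  linarith

/-- A triangle with only the vertex `x` above the line `ab` that covers `u` and is not the triangle
`abc` yields an octahedron. -/
theorem octahedron_of_below (h : Diamond X r e a b c d) (mx : x ∈ X) (my : y ∈ X) (mz : z ∈ X)
    (hne : y ≠ z) (hxy : dist x y ≤ r) (hxz : dist x z ≤ r) (hyz : dist y z ≤ r)
    (hx : 0 < area e a b x) (hy : area e a b y ≤ 0) (hz : area e a b z ≤ 0)
    (hgy : gap e a b c d x y < 0) (hgz : 0 ≤ gap e a b c d x z)
    (hT : ¬ (x = c ∧ y = b ∧ z = a)) : ∃ f, IsOctahedron X r f := by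
  have hxy' : x ≠ y := by rintro rfl; linarith
  have hxz' : z ≠ x := by rintro rfl; linarith
  have hya := h.area_A_neg_of_gap hx hy hgy
  have hzb := h.area_B_pos_of_gap hx hz hgz
  have hyA : y ≠ a := by rintro rfl; exact hgy.not_gt (h.gap_A_pos hx)
  have hzB : z ≠ b := by rintro rfl; exact hgz.not_gt (h.gap_B_neg hx)
  have hxA : x ≠ a := by rintro rfl; simp at hx
  have hxB : x ≠ b := by rintro rfl; simp at hx
  have hyb : y = b ∨ 0 < area e x y b := by
    by_contra! hh
    have := eq_vertex_of_below h.noFour mx my mz hxy' hne hxz' hxy hxz hyz h.memB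
      (by simp) hx hy hz hh.2 hzb.le (by linarith)
    have := hh.1
    tauto
  have hza : z = a ∨ area e x z a < 0 := by
    by_contra! hh
    have := eq_vertex_of_below h.noFour mx my mz hxy' hne hxz' hxy hxz hyz h.memA
      (by simp) hx hy hz hya.le hh.2 (by linarith)
    have := hh.1
    tauto
  rcases hyb with rfl | hyb <;> rcases hza with rfl | hza
  · exact absurd ⟨h.eq_of_common_pos mx (by rwa [dist_comm]) (by rwa [dist_comm]) hx, rfl, rfl⟩ hT
  · have hz' := lt_of_le_of_ne hz (h.area_ne_zero_of_cross mz hza hzb)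
    exact absurd (h.gap_neg_of_edge mx mz (by rwa [dist_comm]) hyz hxz hx hz' hza hzb) hgz.not_gt
  · have hy' := lt_of_le_of_ne hy (h.area_ne_zero_of_cross my hya hyb)
    exact absurd (h.gap_pos_of_edge mx my (by rwa [dist_comm]) (by rwa [dist_comm]) hxy hx hy'
      hya hyb) hgy.not_gt
  · exact h.octahedron_of_cross mx my mz hne hxy hxz hyz hx
      (lt_of_le_of_ne hy (h.area_ne_zero_of_cross my hya hyb))
      (lt_of_le_of_ne hz (h.area_ne_zero_of_cross mz hza hzb)) hya hyb hza hzb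

/-- A triangle with exactly two vertices above the line `ab` that covers `u` yields an octahedron.
-/
theorem octahedron_of_above (h : Diamond X r e a b c d) (mx : x ∈ X) (my : y ∈ X) (mz : z ∈ X)
    (hne : y ≠ z) (hxy : dist x y ≤ r) (hxz : dist x z ≤ r) (hyz : dist y z ≤ r)
    (hx : area e a b x ≤ 0) (hy : 0 < area e a b y) (hz : 0 < area e a b z)
    (hgy : gap e a b c d y x < 0) (hgz : 0 ≤ gap e a b c d z x) : ∃ f, IsOctahedron X r f := by
  have hxy' : x ≠ y := by rintro rfl; linarith
  have hxz' : z ≠ x := by rintro rfl; linarith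
  have hya := h.area_A_neg_of_gap hy hx hgy
  have hzb := h.area_B_pos_of_gap hz hx hgz
  have hyA : y ≠ a := by rintro rfl; simp at hy
  have hyB : y ≠ b := by rintro rfl; simp at hy
  have hzA : z ≠ a := by rintro rfl; simp at hz
  have hzB : z ≠ b := by rintro rfl; simp at hz
  have hxA : x ≠ a := by rintro rfl; exact hgy.not_gt (h.gap_A_pos hy)
  have hxB : x ≠ b := by rintro rfl; exact hgz.not_gt (h.gap_B_neg hz)
  have hyb : 0 < area e y x b := by
    by_contra! hh
    have := eq_vertex_of_above h.noFour mx my mz hxy' hne hxz' hxy hxz hyz h.memB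
      (by simp) hx hy hz hh hzb.le (by linarith)
    tauto
  have hza : area e z x a < 0 := by
    by_contra! hh
    have := eq_vertex_of_above h.noFour mx my mz hxy' hne hxz' hxy hxz hyz h.memA
      (by simp) hx hy hz hya.le hh (by linarith)
    tauto
  have hx' := lt_of_le_of_ne hx (h.area_ne_zero_of_cross mx hya hyb)
  exact h.rotate.octahedron_of_cross mx my mz hne hxy hxz hyz (by rw [area_swap]; linarith)
    (by rw [area_swap]; linarith) (by rw [area_swap]; linarith)
    (by rw [area_swap]; linarith) (by rw [area_swap]; linarith)
    (by rw [area_swap]; linarith) (by rw [area_swap]; linarith)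

end Diamond

/-! ### The longest edge of a planar point set -/

theorem dist_sq_eq (p q : EuclideanSpace ℝ (Fin 2)) :
    dist p q ^ 2 = (p 0 - q 0) ^ 2 + (p 1 - q 1) ^ 2 := by
  rw [EuclideanSpace.dist_eq, Real.sq_sqrt (by positivity), Fin.sum_univ_two, Real.dist_eq,
    Real.dist_eq, sq_abs, sq_abs]

/-- If `c` is on the line `ab` and no farther from `a` and `b` than these from each other, then it
is on the segment `ab`, so a ball around `d` that contains `a` and `b` contains `c`. -/
theorem dist_le_of_area_eq_zero {a b c d : EuclideanSpace ℝ (Fin 2)} {ρ : ℝ} (hne : a ≠ b)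
    (h0 : area 1 a b c = 0) (hac : dist a c ≤ dist a b) (hbc : dist b c ≤ dist a b)
    (had : dist a d ≤ ρ) (hbd : dist b d ≤ ρ) : dist c d ≤ ρ := by
  have e1 := dist_sq_eq a b
  have e2 := dist_sq_eq a c
  have e3 := dist_sq_eq b c
  have i1 : dist a c ^ 2 ≤ dist a b ^ 2 := by gcongr
  have i2 : dist b c ^ 2 ≤ dist a b ^ 2 := by gcongr
  have pos : 0 < dist a b ^ 2 := by have := dist_pos.2 hne; positivity
  refine dist_le_of_combo
    (w₁ := (b 0 - c 0) * (b 0 - a 0) + (b 1 - c 1) * (b 1 - a 1))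
    (w₂ := (c 0 - a 0) * (b 0 - a 0) + (c 1 - a 1) * (b 1 - a 1)) (w₃ := 0)
    (a := a) (b := b) (c := b) (by nlinarith) (by nlinarith) le_rfl (by nlinarith) ?_ had hbd hbd
  simp only [area, one_mul] at h0
  intro i
  fin_cases i
  · simp only [Fin.zero_eta, Fin.isValue]
    linear_combination (a 1 - b 1) * h0
  · simp only [Fin.mk_one, Fin.isValue]
    linear_combination (b 0 - a 0) * h0

/-- Two points on the same side of `ab` whose distances to `a` and `b` are at most `L = ab` are at
distance at most `L`: either one of them lies in the triangle spanned by `ab` and the other, or the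
four points form a convex quadrilateral with sides `ab` and `cd` and diagonals at most `L`. -/
theorem dist_le_of_same_side {e L : ℝ} {a b c d : EuclideanSpace ℝ (Fin 2)}
    (hL : dist a b = L) (hac : dist a c ≤ L) (hbc : dist b c ≤ L) (had : dist a d ≤ L)
    (hbd : dist b d ≤ L) (hc : 0 < area e a b c) (hd : 0 < area e a b d) : dist c d ≤ L := by
  have hL0 : 0 ≤ L := hL ▸ dist_nonneg
  have aux : ∀ c d : EuclideanSpace ℝ (Fin 2), dist a c ≤ L → dist b c ≤ L → dist a d ≤ L →
      dist b d ≤ L → 0 < area e a b c → 0 < area e a b d → 0 ≤ area e a d c → dist c d ≤ L := by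
    intro c d hac hbc had hbd hc hd h
    rcases le_or_gt (area e b c d) 0 with h1 | h1
    · have := (dist_add_dist_le_of_cross (e := e) (a := b) (b := c) (x := a) (y := d)
        (by rw [area_rotate]; exact hc.le) h1
        (by rw [area_swap_right]; linarith) h (by rw [area_rotate e a b c]; linarith)).1
      rw [dist_comm d c] at this
      linarith
    · rw [dist_comm]
      exact dist_le_of_area_nonneg h1.le (by rwa [area_rotate] at h) hd.le hc hac hbc
        (by simpa using hL0)
  rcases le_total 0 (area e a d c) with h | h
  · exact aux c d hac hbc had hbd hc hd h
  · rw [dist_comm]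
    exact aux d c had hbd hac hbc hd hc (by rw [area_swap_right]; linarith)

/-- The point in which the line `ab` meets the segment `cd` is nearer to `b` than `a` is: by strict
convexity it lies in the open ball of radius `ab` around `b`. -/
theorem area_pos_of_longest {e : ℝ} {a b c d : EuclideanSpace ℝ (Fin 2)}
    (hc : 0 < area e a b c) (hd : area e a b d < 0) (hbc : dist b c ≤ dist a b)
    (hbd : dist b d ≤ dist a b) (hcd : c ≠ d) : 0 < area e c a d := by
  have e1 := dist_sq_eq a b
  have e2 := dist_sq_eq b c
  have e3 := dist_sq_eq b d
  have e4 := dist_sq_eq c d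
  have i1 : dist b c ^ 2 ≤ dist a b ^ 2 := by gcongr
  have i2 : dist b d ^ 2 ≤ dist a b ^ 2 := by gcongr
  have pos : 0 < dist c d ^ 2 := by have := dist_pos.2 hcd; positivity
  by_contra! hcon
  have hsum : area e b c d + area e c a d = area e a b c - area e a b d := by
    simp only [area]; ring
  set A := area e b c d with hA
  set C := area e a b c with hC
  set E := -area e a b d with hE
  have hE0 : 0 < E := by simp only [hE]; linarith
  have hAle : C + E ≤ A := by simp only [hE]; linarith
  -- the squared norm of `C • (d - b) + E • (c - b) = A • (a - b)`
  have key : A ^ 2 * dist a b ^ 2 = C ^ 2 * dist b d ^ 2 + E ^ 2 * dist b c ^ 2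
      + C * E * (dist b d ^ 2 + dist b c ^ 2 - dist c d ^ 2) := by
    rw [e1, e2, e3, e4]; simp only [hA, hC, hE, area]; ring
  have k1 : A ^ 2 * dist a b ^ 2 ≥ (C + E) ^ 2 * dist a b ^ 2 := by gcongr
  have k2 : C ^ 2 * dist b d ^ 2 ≤ C ^ 2 * dist a b ^ 2 := by gcongr
  have k3 : E ^ 2 * dist b c ^ 2 ≤ E ^ 2 * dist a b ^ 2 := by gcongr
  have k4 : C * E * (dist b d ^ 2 + dist b c ^ 2 - dist c d ^ 2)
      < C * E * (dist a b ^ 2 + dist a b ^ 2) := by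
    apply mul_lt_mul_of_pos_left _ (mul_pos hc hE0); linarith
  nlinarith

theorem exists_diamond {X : Set (EuclideanSpace ℝ (Fin 2))} {r : ℝ} (hX : NoFourClique X r)
    {a b c d : EuclideanSpace ℝ (Fin 2)} (ha : a ∈ X) (hb : b ∈ X) (hc : c ∈ X) (hd : d ∈ X)
    (hab : dist a b ≤ r) (hmax : ∀ p ∈ X, ∀ q ∈ X, dist p q ≤ r → dist p q ≤ dist a b)
    (hne : a ≠ b) (hca : c ≠ a) (hcb : c ≠ b) (hda : d ≠ a) (hdb : d ≠ b) (hcd : c ≠ d)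
    (hac : dist a c ≤ r) (hbc : dist b c ≤ r) (had : dist a d ≤ r) (hbd : dist b d ≤ r) :
    ∃ e, Diamond X r e a b c d := by
  have far : ∀ p ∈ X, ∀ q ∈ X, dist a p ≤ r → dist b p ≤ r → dist a q ≤ r → dist b q ≤ r →
      p ≠ a → p ≠ b → q ≠ a → q ≠ b → p ≠ q → r < dist p q := by
    intro p hp q hq h1 h2 h3 h4 n1 n2 n3 n4 n5
    by_contra! hh
    have := hX a ha b hb p hp q hq hne n2.symm n1 hab h2 (by rwa [dist_comm]) h3 h4 hh
    have := n5.symm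
    tauto
  have nonzero : ∀ p ∈ X, ∀ q ∈ X, dist a p ≤ r → dist b p ≤ r → dist a q ≤ r → dist b q ≤ r →
      p ≠ a → p ≠ b → q ≠ a → q ≠ b → p ≠ q → area 1 a b p ≠ 0 := by
    intro p hp q hq h1 h2 h3 h4 n1 n2 n3 n4 n5 h0
    exact (far p hp q hq h1 h2 h3 h4 n1 n2 n3 n4 n5).not_ge (dist_le_of_area_eq_zero hne h0
      (hmax a ha p hp h1) (hmax b hb p hp h2) h3 h4)
  have opposite : ∀ e, ∀ p ∈ X, ∀ q ∈ X, dist a p ≤ r → dist b p ≤ r → dist a q ≤ r →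
      dist b q ≤ r → p ≠ a → p ≠ b → q ≠ a → q ≠ b → p ≠ q → 0 < area e a b p →
      ¬ 0 < area e a b q := by
    intro e p hp q hq h1 h2 h3 h4 n1 n2 n3 n4 n5 hp0 hq0
    exact (far p hp q hq h1 h2 h3 h4 n1 n2 n3 n4 n5).not_ge ((dist_le_of_same_side rfl
      (hmax a ha p hp h1) (hmax b hb p hp h2) (hmax a ha q hq h3) (hmax b hb q hq h4)
      hp0 hq0).trans hab)
  obtain ⟨e, he, hce⟩ : ∃ e, (e = 1 ∨ e = -1) ∧ 0 < area e a b c := by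
    rcases lt_or_gt_of_ne (nonzero c hc d hd hac hbc had hbd hca hcb hda hdb hcd) with h | h
    · exact ⟨-1, Or.inr rfl, by rw [area_neg]; linarith⟩
    · exact ⟨1, Or.inl rfl, h⟩
  have nonzero' : ∀ p, area 1 a b p ≠ 0 → area e a b p ≠ 0 := by
    intro p hp
    rcases he with rfl | rfl
    · exact hp
    · rwa [area_neg, neg_ne_zero]
  have hde : area e a b d < 0 := lt_of_le_of_ne
    (not_lt.1 (opposite e c hc d hd hac hbc had hbd hca hcb hda hdb hcd hce))
    (nonzero' d (nonzero d hd c hc had hbd hac hbc hda hdb hca hcb hcd.symm))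
  refine ⟨e, hX, ha, hb, hc, hd, hab, hac, hbc, had, hbd,
    far c hc d hd hac hbc had hbd hca hcb hda hdb hcd, hce, hde, ?_,
    area_pos_of_longest hce hde (hmax b hb c hc hbc) (hmax b hb d hd hbd) hcd, ?_⟩
  · rw [area_rotate]
    exact area_pos_of_longest (by rw [area_swap]; linarith) (by rw [area_swap]; linarith)
      (by rw [dist_comm b a]; exact hmax a ha d hd had)
      (by rw [dist_comm b a]; exact hmax a ha c hc hac) hcd.symm
  · intro v hv hav hbv
    by_contra! hcon
    obtain ⟨n1, n2, n3, n4⟩ := hcon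
    rcases lt_or_gt_of_ne (nonzero' v (nonzero v hv c hc hav hbv hac hbc n1 n2 hca hcb n3))
      with h | h
    · exact opposite (-e) v hv d hd hav hbv had hbd n1 n2 hda hdb n4
        (by rw [area_neg]; linarith) (by rw [area_neg]; linarith)
    · exact opposite e v hv c hc hav hbv hac hbc n1 n2 hca hcb n3 h hce

/-! ### Coefficients of simplicial 2-cycles -/

section Algebra

universe u v

variable {R : Type u} [CommRing R] {V : Type v}

/-- The boundary of a 2-chain, paired with an arbitrary function `φ` of two vertices. -/
theorem sum_cycle_eq_zero {K : PreAbstractSimplicialComplex V} {c : (Fin 3 → V) →₀ R}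
    (hc : c ∈ cycles R K 2) (φ : V → V → R) :
    ∑ x ∈ c.support, c x * φ (x 1) (x 2) = 0 := by
  have h0 : boundary R 2 c = 0 := hc.2
  have : (boundary R 2 c).sum (fun y m => m * φ (y 0) (y 1)) = 0 := by rw [h0]; simp
  rw [boundary, Finsupp.lmapDomain_apply, Finsupp.sum_mapDomain_index (by simp)
    (by intros; ring)] at this
  exact this

/-- The covering argument. The relation `G`, restricted to pairs that descend from a vertex
satisfying `up` to one that does not, selects certain edges of the support of a cycle. If some
triangle `x₀` has exactly one selected edge, then so has another one, since the contributions of a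
triangle with two selected edges to `sum_cycle_eq_zero` cancel. -/
theorem exists_unbalanced {K : PreAbstractSimplicialComplex V} {c : (Fin 3 → V) →₀ R}
    (hc : c ∈ cycles R K 2) (up : V → Prop) (G : V → V → Prop) {x₀ : Fin 3 → V} (hx₀ : c x₀ ≠ 0)
    (h₀ : ¬ up (x₀ 0)) (h₁ : up (x₀ 1)) (h₂ : ¬ up (x₀ 2)) (h₃ : G (x₀ 1) (x₀ 2))
    (h₄ : ¬ G (x₀ 1) (x₀ 0)) :
    ∃ w, c w ≠ 0 ∧ w ≠ x₀ ∧ up (w 1) ∧ ¬ up (w 2) ∧ G (w 1) (w 2) ∧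
      (¬ up (w 0) ∧ ¬ G (w 1) (w 0) ∨ up (w 0) ∧ ¬ G (w 0) (w 2)) := by
  classical
  by_contra! hcon
  have hsum := sum_cycle_eq_zero hc (fun x y => if up x ∧ ¬ up y ∧ G x y then 1 else 0)
  simp only [mul_ite, mul_one, mul_zero] at hsum
  rw [← Finset.sum_filter] at hsum
  have hmem : x₀ ∈ c.support.filter (fun x => up (x 1) ∧ ¬ up (x 2) ∧ G (x 1) (x 2)) := by
    simp [*]
  rw [← Finset.add_sum_erase _ _ hmem] at hsum
  apply hx₀
  rw [← hsum, left_eq_add]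
  have swap_apply : ∀ (x : Fin 3 → V) (i j : Fin 3), i ≠ j → c (x ∘ Equiv.swap i j) = - c x := by
    intro x i j hij
    rw [hc.1.2 x, Equiv.Perm.sign_swap hij]; simp
  have e20 : Equiv.swap (0 : Fin 3) 2 1 = 1 := by decide
  have e12 : Equiv.swap (0 : Fin 3) 1 2 = 2 := by decide
  have key : ∀ x ∈ (c.support.filter
      (fun x => up (x 1) ∧ ¬ up (x 2) ∧ G (x 1) (x 2))).erase x₀,
      c x ≠ 0 ∧ x ≠ x₀ ∧ up (x 1) ∧ ¬ up (x 2) ∧ G (x 1) (x 2) ∧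
        (¬ up (x 0) → G (x 1) (x 0)) ∧ (up (x 0) → G (x 0) (x 2)) := by
    intro x hx
    simp only [Finset.mem_erase, Finset.mem_filter, Finsupp.mem_support_iff] at hx
    have := hcon x hx.2.1 hx.1 hx.2.2.1 hx.2.2.2.1 hx.2.2.2.2
    tauto
  -- exchange the two descending edges of the triangle
  refine Finset.sum_involution
    (fun x _ => x ∘ Equiv.swap 0 (if up (x 0) then 1 else 2)) ?_ ?_ ?_ ?_
  · intro x hx
    split_ifs <;> rw [swap_apply _ _ _ (by decide)] <;> simp
  · intro x hx hne heq
    have hinj := (hc.1.1 x hne).1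
    have := hinj (congrFun heq 0)
    split_ifs at this <;> simp at this
  · intro x hx
    obtain ⟨k1, k2, k3, k4, k5, k6, k7⟩ := key x hx
    simp only [Finset.mem_erase, Finset.mem_filter, Finsupp.mem_support_iff]
    split_ifs with hup
    · refine ⟨?_, ?_, ?_⟩
      · rintro rfl
        exact h₀ (by simpa using k3)
      · rw [swap_apply _ _ _ (by decide)]; simpa
      · simp [e12, hup, k4, k7]
    · refine ⟨?_, ?_, ?_⟩
      · rintro rfl
        apply h₄
        simpa [e20] using k5
      · rw [swap_apply _ _ _ (by decide)]; simpa
      · simp [e20, hup, k3, k6]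
  · intro x hx
    obtain ⟨k1, k2, k3, k4, k5, k6, k7⟩ := key x hx
    funext i
    by_cases hup : up (x 0)
    · simp [hup, k3]
    · simp [hup, k4]

/-- The edge opposite to the first vertex of a triangle in the support of a 2-cycle lies in a second
triangle of the support. -/
theorem exists_second_triangle {K : PreAbstractSimplicialComplex V} {c : (Fin 3 → V) →₀ R}
    (hc : c ∈ cycles R K 2) {x₀ : Fin 3 → V} (hx₀ : c x₀ ≠ 0) :
    ∃ w, c w ≠ 0 ∧ w 0 ≠ x₀ 0 ∧ w 1 = x₀ 1 ∧ w 2 = x₀ 2 := by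
  classical
  by_contra! hcon
  have hsum := sum_cycle_eq_zero hc (fun x y => if x = x₀ 1 ∧ y = x₀ 2 then 1 else 0)
  apply hx₀
  rw [← hsum, Finset.sum_eq_single x₀]
  · simp
  · intro w hw hne
    rw [if_neg, mul_zero]
    rintro ⟨h1, h2⟩
    refine hcon w (Finsupp.mem_support_iff.1 hw) (fun h0 => hne ?_) h1 h2
    funext i; fin_cases i <;> assumption
  · intro h
    simp at h
    simp [h]

/-! ### Minimal cycles -/

theorem chains_eq_bot {K : PreAbstractSimplicialComplex V} {n : ℕ}
    (h : ∀ s ∈ K, s.card ≤ n) : chains R K n = ⊥ := by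
  classical
  rw [eq_bot_iff]
  intro c hc
  rw [Submodule.mem_bot]
  ext x
  by_contra hx
  obtain ⟨hinj, s, hs, hsx⟩ := hc.1 x hx
  have h1 : s = Finset.univ.image x := by
    rw [← Finset.coe_inj, hsx]; simp
  have h2 := h s hs
  rw [h1, Finset.card_image_of_injective _ hinj] at h2
  simp at h2

/-- In the top dimension there are no boundaries. -/
theorem rank_homology_eq {K : PreAbstractSimplicialComplex V} {n : ℕ}
    (h : ∀ s ∈ K, s.card ≤ n + 1) :
    Module.rank R (Homology R K n) = Module.rank R (cycles R K n) := by
  have : (boundaries R K n).submoduleOf (cycles R K n) = ⊥ := by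
    rw [boundaries, chains_eq_bot h, Submodule.map_bot, Submodule.submoduleOf, Submodule.comap_bot,
      Submodule.ker_subtype]
  exact ((Submodule.quotEquivOfEqBot _ this)).rank_eq

theorem chains_mono {K L : PreAbstractSimplicialComplex V} (h : L ≤ K) (n : ℕ) :
    chains R L n ≤ chains R K n := by
  intro c hc
  refine ⟨fun x hx => ?_, hc.2⟩
  obtain ⟨h1, s, hs, h2⟩ := hc.1 x hx
  exact ⟨h1, s, h hs, h2⟩

theorem IsMinimalCycle.exists_cycle [Nontrivial R] {K : PreAbstractSimplicialComplex V} {n : ℕ}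
    (hK : IsMinimalCycle R K n) : ∃ c ∈ cycles R K n, c ≠ 0 := by
  have h1 := (hK.2.2 K le_rfl).2 rfl
  rw [rank_homology_eq hK.2.1.1.2] at h1
  by_contra! hcon
  have : cycles R K n = ⊥ := by
    rw [eq_bot_iff]
    exact fun c hc => hcon c hc
  rw [this] at h1
  simp at h1

/-- A subcomplex of a minimal cycle that carries a nonzero cycle has homology of rank one, since its
cycles form a submodule of a module of rank one. Hence it is the whole complex. -/
theorem IsMinimalCycle.eq_of_cycle [IsDomain R] {K L : PreAbstractSimplicialComplex V} {n : ℕ}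
    (hK : IsMinimalCycle R K (n + 1)) (hL : L ≤ K) {c : (Fin (n + 2) → V) →₀ R}
    (hc : c ∈ cycles R L (n + 1)) (hne : c ≠ 0) : L = K := by
  have h1 := (hK.2.2 K le_rfl).2 rfl
  have hdim := hK.2.1.1.2
  rw [rank_homology_eq hdim] at h1
  rw [← hK.2.2 L hL, rank_homology_eq (fun s hs => hdim s (hL hs))]
  apply le_antisymm
  · rw [← h1]
    exact Submodule.rank_mono (inf_le_inf_right _ (chains_mono hL _))
  · rw [Cardinal.one_le_iff_pos]
    exact (rank_pos_iff_exists_ne_zero (R := R) (M := cycles R L (n + 1))).2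
      ⟨⟨c, hc⟩, fun h => hne (congrArg Subtype.val h)⟩

/-- The faces of `K` that lie in a simplex on which the chain `c` does not vanish. -/
def supportComplex (K : PreAbstractSimplicialComplex V) {n : ℕ} (c : (Fin (n + 1) → V) →₀ R) :
    PreAbstractSimplicialComplex V where
  faces := {s | s ∈ K ∧ ∃ x, c x ≠ 0 ∧ (s : Set V) ⊆ Set.range x}
  isRelLowerSet_faces := fun {_} hs =>
    ⟨(K.isRelLowerSet_faces hs.1).1, fun _ hts ht =>
      ⟨(K.isRelLowerSet_faces hs.1).2 hts ht, hs.2.imp fun _ hx =>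
        ⟨hx.1, (Finset.coe_subset.2 hts).trans hx.2⟩⟩⟩

/-- A minimal cycle is the support of each of its nonzero cycles. -/
theorem IsMinimalCycle.exists_support [IsDomain R] {K : PreAbstractSimplicialComplex V} {n : ℕ}
    (hK : IsMinimalCycle R K (n + 1)) {c : (Fin (n + 2) → V) →₀ R}
    (hc : c ∈ cycles R K (n + 1)) (hne : c ≠ 0) {s : Finset V} (hs : s ∈ K) :
    ∃ x, c x ≠ 0 ∧ (s : Set V) ⊆ Set.range x := by
  have hle : supportComplex K c ≤ K := fun s hs => hs.1
  have hc' : c ∈ cycles R (supportComplex K c) (n + 1) := by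
    refine ⟨⟨fun x hx => ?_, hc.1.2⟩, hc.2⟩
    obtain ⟨h1, t, ht, h2⟩ := hc.1.1 x hx
    exact ⟨h1, t, ⟨ht, x, hx, h2.le⟩, h2⟩
  rw [← hK.eq_of_cycle hle hc' hne] at hs
  exact hs.2

/-! ### Embedded octahedra -/

/-- The image of the boundary of the cross-polytope under an embedding of its vertices. -/
def crossPolytopeImage {n : ℕ} (f : Fin (n + 1) × Bool ↪ V) : PreAbstractSimplicialComplex V where
  faces := {s | ∃ t ∈ crossPolytopeBoundary n, t.map f = s}
  isRelLowerSet_faces := by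
    rintro _ ⟨t, ht, rfl⟩
    refine ⟨ht.1.map, fun s hs hne => ?_⟩
    obtain ⟨u, hu, rfl⟩ := Finset.subset_map_iff.1 hs
    exact ⟨u, ((crossPolytopeBoundary n).isRelLowerSet_faces ht).2 hu (Finset.map_nonempty.1 hne),
      rfl⟩

theorem isomorphic_crossPolytopeImage {n : ℕ} (f : Fin (n + 1) × Bool ↪ V) :
    Isomorphic (crossPolytopeImage f) (crossPolytopeBoundary n) := by
  let g : vertices (crossPolytopeBoundary n) → vertices (crossPolytopeImage f) :=
    fun v => ⟨f v, {v.1}, v.2, by simp⟩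
  have hg : Function.Bijective g := by
    refine ⟨fun v w h => Subtype.ext (f.injective (congrArg Subtype.val h)), ?_⟩
    rintro ⟨v, t, ht, hv⟩
    obtain ⟨w, rfl⟩ : ∃ w, t = {w} := by
      rw [← Finset.card_eq_one, ← Finset.card_map f, hv, Finset.card_singleton]
    rw [Finset.map_singleton, Finset.singleton_inj] at hv
    exact ⟨⟨w, ht⟩, Subtype.ext hv⟩
  let e := Equiv.ofBijective g hg
  refine ⟨e.symm, fun s => ?_⟩
  have hs : s.map (Function.Embedding.subtype _) =
      ((s.map e.symm.toEmbedding).map (Function.Embedding.subtype _)).map f := by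
    rw [Finset.map_map, Finset.map_map]
    congr 1
    ext v
    exact congrArg Subtype.val (e.apply_symm_apply v).symm
  rw [hs]
  constructor
  · rintro ⟨t, ht, h⟩
    rwa [← Finset.map_injective f h]
  · exact fun h => ⟨_, h, rfl⟩

end Algebra

section Octahedron

universe u v

variable (R : Type u) [CommRing R] {V : Type v}

open Classical in
/-- The function on the vertices that is `1` and `-1` at the two poles of the `i`-th axis and `0`
elsewhere: the fundamental cycle of the `0`-sphere formed by the poles. -/
noncomputable def poleSign (f : Fin 3 × Bool ↪ V) (i : Fin 3) (v : V) : R :=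
  (if v = f (i, true) then 1 else 0) - (if v = f (i, false) then 1 else 0)

open Classical in
/-- The fundamental cycle of an embedded octahedron, as the join of the three `0`-spheres of poles:
the value at a tuple of vertices is the determinant of the values of the functions `poleSign`. -/
noncomputable def octahedronCycle (f : Fin 3 × Bool ↪ V) : (Fin 3 → V) →₀ R :=
  Finsupp.onFinset (Fintype.piFinset fun _ => Finset.univ.map f)
    (fun x => (Matrix.of fun k i => poleSign R f i (x k)).det) (by
      intro x hx
      rw [Fintype.mem_piFinset]
      intro k
      by_contra hk
      refine hx (Matrix.det_eq_zero_of_row_eq_zero k fun i => ?_)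
      simp only [Finset.mem_map, Finset.mem_univ, true_and, not_exists] at hk
      rw [Matrix.of_apply, poleSign, if_neg (fun h => hk _ h.symm), if_neg (fun h => hk _ h.symm),
        sub_zero])

theorem octahedronCycle_apply (f : Fin 3 × Bool ↪ V) (x : Fin 3 → V) :
    octahedronCycle R f x = (Matrix.of fun k i => poleSign R f i (x k)).det := rfl

theorem mem_map_of_octahedronCycle_ne_zero {f : Fin 3 × Bool ↪ V} {x : Fin 3 → V}
    (hx : octahedronCycle R f x ≠ 0) (k : Fin 3) : x k ∈ Finset.univ.map f :=
  Fintype.mem_piFinset.1 (Finsupp.support_onFinset_subset (Finsupp.mem_support_iff.2 hx)) k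

theorem poleSign_true (f : Fin 3 × Bool ↪ V) (i j : Fin 3) :
    poleSign R f i (f (j, true)) = if i = j then 1 else 0 := by
  simp [poleSign, eq_comm]

theorem poleSign_false (f : Fin 3 × Bool ↪ V) (i j : Fin 3) :
    poleSign R f i (f (j, false)) = - if i = j then 1 else 0 := by
  simp [poleSign, eq_comm]

theorem octahedronCycle_ne_zero [Nontrivial R] (f : Fin 3 × Bool ↪ V) :
    octahedronCycle R f ≠ 0 := by
  intro h
  have := DFunLike.congr_fun h (fun k => f (k, true))
  rw [octahedronCycle_apply] at this
  have h1 : (Matrix.of fun k i : Fin 3 => poleSign R f i (f (k, true))) = 1 := by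
    ext k i
    simp [poleSign_true, Matrix.one_apply, eq_comm]
  rw [h1] at this
  simp at this

theorem sum_poleSign (f : Fin 3 × Bool ↪ V) (i : Fin 3) :
    ∑ v ∈ Finset.univ.map f, poleSign R f i v = 0 := by
  rw [Finset.sum_map, Fintype.sum_prod_type]
  simp [poleSign_true, poleSign_false]

theorem boundary_octahedronCycle (f : Fin 3 × Bool ↪ V) :
    boundary R 2 (octahedronCycle R f) = 0 := by
  classical
  ext y
  rw [boundary_apply, Finsupp.zero_apply]
  have h1 : ∑ v ∈ Finset.univ.map f, octahedronCycle R f (Fin.cons v y) = 0 := by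
    simp only [octahedronCycle_apply, Matrix.det_fin_three, Matrix.of_apply, Fin.cons_zero,
      Finset.sum_sub_distrib, Finset.sum_add_distrib, Fin.cons_one,
      show (2 : Fin 3) = Fin.succ 1 from rfl, Fin.cons_succ, ← Finset.sum_mul,
      sum_poleSign, zero_mul, sub_zero, add_zero]
  -- the tuples in the support with tail `y` are of the form `Fin.cons v y` for a vertex `v`
  rw [← h1]
  symm
  rw [← Finset.sum_image (f := fun x => octahedronCycle R f x)
    (g := fun v => (Fin.cons v y : Fin 3 → V)) (fun _ _ _ _ h => (Fin.cons_inj.1 h).1)]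
  symm
  refine Finset.sum_subset (fun x hx => ?_) (fun x hx hx' => ?_)
  · rw [Finset.mem_filter, Finsupp.mem_support_iff] at hx
    rw [Finset.mem_image]
    have h2 := mem_map_of_octahedronCycle_ne_zero R hx.1 0
    exact ⟨x 0, h2, by rw [← hx.2]; exact Fin.cons_self_tail x⟩
  · obtain ⟨v, -, rfl⟩ := Finset.mem_image.1 hx
    by_contra h
    exact hx' (Finset.mem_filter.2 ⟨Finsupp.mem_support_iff.2 h, Fin.tail_cons _ _⟩)

theorem octahedronCycle_mem_cycles (f : Fin 3 × Bool ↪ V) :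
    octahedronCycle R f ∈ cycles R (crossPolytopeImage f) 2 := by
  classical
  refine ⟨⟨fun x hx => ?_, fun x σ => ?_⟩, ?_⟩
  · have hinj : Function.Injective x := by
      intro j k hjk
      by_contra hne
      exact hx (Matrix.det_zero_of_row_eq hne (by ext i; simp [hjk]))
    refine ⟨hinj, Finset.univ.image x, ?_, by simp⟩
    have hmem : ∀ k, ∃ p, f p = x k := by
      intro k
      simpa using mem_map_of_octahedronCycle_ne_zero R hx k
    choose p hp using hmem
    refine ⟨Finset.univ.image p, ⟨Finset.univ_nonempty.image _, fun i hi => ?_⟩, ?_⟩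
    · simp only [Finset.mem_image, Finset.mem_univ, true_and] at hi
      obtain ⟨⟨j, hj⟩, ⟨k, hk⟩⟩ := hi
      have hjk : j ≠ k := by rintro rfl; simp [hj] at hk
      apply hx
      -- opposite poles give opposite rows of the matrix
      rw [octahedronCycle_apply, ← Matrix.det_updateRow_add_self _ hjk]
      refine Matrix.det_eq_zero_of_row_eq_zero j fun l => ?_
      rw [Matrix.updateRow_self]
      simp [← hp, hj, hk, poleSign_true, poleSign_false]
    · ext v
      simp [← hp]
  · rw [octahedronCycle_apply, octahedronCycle_apply]
    have := Matrix.det_permute σ (Matrix.of fun k i => poleSign R f i (x k))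
    rw [zsmul_eq_mul, ← this]
    rfl
  · exact boundary_octahedronCycle R f

end Octahedron

/-! ### Octahedra in planar Rips complexes -/

theorem mem_ripsComplex_of_dist {X : Set (EuclideanSpace ℝ (Fin 2))} {r : ℝ} (hr : 0 ≤ r)
    {s : Finset (EuclideanSpace ℝ (Fin 2))} (hs : s.Nonempty) (hX : ∀ p ∈ s, p ∈ X)
    (h : ∀ p ∈ s, ∀ q ∈ s, dist p q ≤ r) : s ∈ ripsComplex X r :=
  ⟨hs, hX, Metric.diam_le_of_forall_dist_le hr h⟩

theorem dist_le_of_mem_ripsComplex {X : Set (EuclideanSpace ℝ (Fin 2))} {r : ℝ}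
    {s : Finset (EuclideanSpace ℝ (Fin 2))} (hs : s ∈ ripsComplex X r)
    {p q : EuclideanSpace ℝ (Fin 2)} (hp : p ∈ s) (hq : q ∈ s) : dist p q ≤ r :=
  (Metric.dist_le_diam_of_mem s.finite_toSet.isBounded hp hq).trans hs.2.2

theorem noFourClique_of_card_le {X : Set (EuclideanSpace ℝ (Fin 2))} {r : ℝ} (hr : 0 ≤ r)
    (h : ∀ s ∈ ripsComplex X r, s.card ≤ 3) : NoFourClique X r := by
  classical
  intro p hp q hq s hs v hv hpq hqs hsp dpq dqs dsp dpv dqv dsv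
  by_contra! hcon
  obtain ⟨h1, h2, h3⟩ := hcon
  have := h {v, p, q, s} (mem_ripsComplex_of_dist hr (by simp) (by simp [*]) (by
    simp only [Finset.mem_insert, Finset.mem_singleton]
    rintro x (rfl | rfl | rfl | rfl) y (rfl | rfl | rfl | rfl) <;>
      first
        | assumption
        | (rw [dist_comm]; assumption)
        | simpa using hr))
  rw [Finset.card_insert_of_notMem (by simp [*]),
    Finset.card_insert_of_notMem (by simp [*, hsp.symm]),
    Finset.card_insert_of_notMem (by simp [*]), Finset.card_singleton] at this
  omega

/-- Points at distance zero are adjacent to the same points, and `f i` is not adjacent to its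
antipode only. -/
theorem IsOctahedron.injective {X : Set (EuclideanSpace ℝ (Fin 2))} {r : ℝ} (hr : 0 ≤ r)
    {f : Fin 3 × Bool → EuclideanSpace ℝ (Fin 2)} (hf : IsOctahedron X r f) :
    Function.Injective f := by
  rintro ⟨i, s⟩ ⟨j, t⟩ h
  have h1 := hf.2 (i, s) (j, t)
  rw [h] at h1
  have h2 := hf.2 (i, s) (i, !s)
  rw [h, hf.2] at h2
  simp [hr] at h1 h2
  simp only [Prod.mk.injEq]
  exact ⟨h2.1.symm, h1 h2.1.symm⟩

theorem IsOctahedron.crossPolytopeImage_le {X : Set (EuclideanSpace ℝ (Fin 2))} {r : ℝ}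
    (hr : 0 ≤ r) {f : Fin 3 × Bool ↪ EuclideanSpace ℝ (Fin 2)} (hf : IsOctahedron X r f) :
    crossPolytopeImage f ≤ ripsComplex X r := by
  rintro _ ⟨t, ht, rfl⟩
  refine mem_ripsComplex_of_dist hr ht.1.map ?_ ?_
  · intro p hp
    obtain ⟨i, -, rfl⟩ := Finset.mem_map.1 hp
    exact hf.1 i
  · intro p hp q hq
    obtain ⟨⟨i, s⟩, hi, rfl⟩ := Finset.mem_map.1 hp
    obtain ⟨⟨j, t'⟩, hj, rfl⟩ := Finset.mem_map.1 hq
    rw [hf.2]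
    rintro ⟨rfl : i = j, hst : s ≠ t'⟩
    apply ht.2 i
    cases s <;> cases t' <;> simp_all

theorem exists_longest_edge {X : Set (EuclideanSpace ℝ (Fin 2))} (hX : X.Finite) {r : ℝ}
    {p q : EuclideanSpace ℝ (Fin 2)} (hp : p ∈ X) (hq : q ∈ X) (hne : p ≠ q) (hpq : dist p q ≤ r) :
    ∃ a ∈ X, ∃ b ∈ X, a ≠ b ∧ dist a b ≤ r ∧
      ∀ x ∈ X, ∀ y ∈ X, dist x y ≤ r → dist x y ≤ dist a b := by
  obtain ⟨⟨a, b⟩, ⟨⟨ha, hb⟩, hab, hab'⟩, hmax⟩ := Set.exists_max_image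
    {e ∈ X ×ˢ X | e.1 ≠ e.2 ∧ dist e.1 e.2 ≤ r} (fun e => dist e.1 e.2)
    ((hX.prod hX).subset (Set.sep_subset _ _)) ⟨(p, q), ⟨hp, hq⟩, hne, hpq⟩
  refine ⟨a, ha, b, hb, hab, hab', fun x hx y hy hxy => ?_⟩
  rcases eq_or_ne x y with rfl | h
  · simp
  · exact hmax (x, y) ⟨⟨hx, hy⟩, h, hxy⟩

/-- If a planar Rips complex is a minimal 2-cycle, its points contain the vertices of an
octahedron. -/
theorem exists_octahedron {R : Type*} [CommRing R] [IsDomain R]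
    {X : Set (EuclideanSpace ℝ (Fin 2))} (hfin : X.Finite) {r : ℝ} (hr : 0 < r)
    (hmin : IsMinimalCycle R (ripsComplex X r) 2) : ∃ f, IsOctahedron X r f := by
  classical
  have hX := noFourClique_of_card_le hr.le hmin.2.1.1.2
  obtain ⟨z, hz, hz0⟩ := hmin.exists_cycle
  have mem : ∀ w, z w ≠ 0 → ∀ i, w i ∈ X := by
    intro w hw i
    obtain ⟨-, s, hs, hsw⟩ := hz.1.1 w hw
    exact hs.2.1 (hsw ▸ Set.mem_range_self i)
  have close : ∀ w, z w ≠ 0 → ∀ i j, dist (w i) (w j) ≤ r := by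
    intro w hw i j
    obtain ⟨-, s, hs, hsw⟩ := hz.1.1 w hw
    refine dist_le_of_mem_ripsComplex hs ?_ ?_ <;>
    · rw [← Finset.mem_coe, hsw]; exact Set.mem_range_self _
  have ne : ∀ w, z w ≠ 0 → ∀ i j, i ≠ j → w i ≠ w j :=
    fun w hw i j hij h => hij ((hz.1.1 w hw).1 h)
  have perm : ∀ w, z w ≠ 0 → ∀ σ : Equiv.Perm (Fin 3), z (w ∘ σ) ≠ 0 := by
    intro w hw σ
    rw [hz.1.2]
    rcases Int.units_eq_one_or (Equiv.Perm.sign σ) with h | h <;> simp [h, hw]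
  obtain ⟨w₀, hw₀⟩ := Finsupp.ne_iff.1 hz0
  rw [Finsupp.zero_apply] at hw₀
  obtain ⟨a, ha, b, hb, hne, hab, hmax⟩ := exists_longest_edge hfin (mem w₀ hw₀ 0) (mem w₀ hw₀ 1)
    (ne w₀ hw₀ 0 1 (by decide)) (close w₀ hw₀ 0 1)
  obtain ⟨y, hy, hya, hyb⟩ : ∃ y, z y ≠ 0 ∧ y 1 = a ∧ y 2 = b := by
    obtain ⟨x, hx, hxab⟩ := hmin.exists_support hz hz0 (s := {a, b})
      (mem_ripsComplex_of_dist hr.le (by simp) (by simp [ha, hb]) (by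
        simp only [Finset.mem_insert, Finset.mem_singleton]
        have hba : dist b a ≤ r := by rwa [dist_comm]
        rintro p (rfl | rfl) q (rfl | rfl) <;> simp [hab, hba, hr.le]))
    obtain ⟨i, hi⟩ := hxab (show a ∈ _ by simp)
    obtain ⟨j, hj⟩ := hxab (show b ∈ _ by simp)
    have hij : i ≠ j := by rintro rfl; exact hne (hi.symm.trans hj)
    obtain ⟨σ, hσ1, hσ2⟩ : ∃ σ : Equiv.Perm (Fin 3), σ 1 = i ∧ σ 2 = j := by
      clear hi hj; revert i j; decide
    exact ⟨x ∘ σ, perm x hx σ, by simp [hσ1, hi], by simp [hσ2, hj]⟩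
  obtain ⟨w, hw, hw0, hwa, hwb⟩ := exists_second_triangle hz hy
  rw [hya] at hwa
  rw [hyb] at hwb
  obtain ⟨e, h⟩ := exists_diamond hX ha hb (mem y hy 0) (mem w hw 0) hab hmax hne
    (hya ▸ ne y hy 0 1 (by decide)) (hyb ▸ ne y hy 0 2 (by decide))
    (hwa ▸ ne w hw 0 1 (by decide)) (hwb ▸ ne w hw 0 2 (by decide)) hw0.symm
    (hya ▸ close y hy 1 0) (hyb ▸ close y hy 2 0) (hwa ▸ close w hw 1 0) (hwb ▸ close w hw 2 0)
  -- the triangle `abc` has one edge, `cb`, that descends across the line `ab` beyond `u`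
  obtain ⟨v, hv, hvne, v1, v2, hv12, hv'⟩ := exists_unbalanced hz (fun p => 0 < area e a b p)
    (fun p q => Diamond.gap e a b (y 0) (w 0) p q < 0) (x₀ := y ∘ Equiv.swap 0 1)
    (perm y hy _) (by simp [hya]) (by simpa using h.posC)
    (by simp [Equiv.swap_apply_of_ne_of_ne, hyb])
    (by simpa [Equiv.swap_apply_of_ne_of_ne, hyb] using h.gap_B_neg h.posC)
    (by simpa [hya] using (h.gap_A_pos h.posC).le)
  have v10 := close v hv 1 0
  have v20 := close v hv 2 0
  have v12 := close v hv 1 2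
  have v21 := close v hv 2 1
  rcases hv' with ⟨v0, hg⟩ | ⟨v0, hg⟩
  · refine h.octahedron_of_below (mem v hv 1) (mem v hv 2) (mem v hv 0) (ne v hv 2 0 (by decide))
      v12 v10 v20 v1 (not_lt.1 v2) (not_lt.1 v0) hv12 (not_lt.1 hg) ?_
    rintro ⟨h1, h2, h3⟩
    refine hvne (funext fun i => ?_)
    fin_cases i
    · simpa [hya] using h3
    · simpa using h1
    · simpa [Equiv.swap_apply_of_ne_of_ne, hyb] using h2
  · exact h.octahedron_of_above (mem v hv 2) (mem v hv 1) (mem v hv 0) (ne v hv 1 0 (by decide))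
      v21 v20 v10 (not_lt.1 v2) v1 v0 hv12 (not_lt.1 hg)

end PlanarRips

theorem mainTheorem4 {R : Type*} [CommRing R] [IsDomain R]
    (X : Set (EuclideanSpace ℝ (Fin 2))) (hX : X.Finite) (r : ℝ) (hr : 0 < r)
    (hmin : PlanarRips.IsMinimalCycle R (PlanarRips.ripsComplex X r) 2) :
    PlanarRips.Isomorphic (PlanarRips.ripsComplex X r) (PlanarRips.crossPolytopeBoundary 2) := by
  obtain ⟨f, hf⟩ := PlanarRips.exists_octahedron hX hr hmin
  let g : Fin 3 × Bool ↪ EuclideanSpace ℝ (Fin 2) := ⟨f, hf.injective hr.le⟩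
  rw [← hmin.eq_of_cycle (PlanarRips.IsOctahedron.crossPolytopeImage_le hr.le (f := g) hf)
    (PlanarRips.octahedronCycle_mem_cycles R g) (PlanarRips.octahedronCycle_ne_zero R g)]
  exact PlanarRips.isomorphic_crossPolytopeImage g
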